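/- **Setting.** Let $H=(V,E)$ be a finite multi-hypergraph ($E$ is a finite multiset of subsets of $V$; repeated and empty edges are allowed) that is connected and has more than one edge. Let $$\mu=MVC_{1/2}(H)=\min_f\Big(\sum_{v\in V}f(v)+\tfrac12\sum_{e\in E}f(e)\Big),$$ the minimum being over all $f:V\cup E\to[0,\infty]$ with $\sum_{v\in e}f(v)+f(e)\ge 1$ for every $e\in E$. **The game $\mathtt{PromiseCounting}(H,n,T,\varepsilon)$.** Let $n\ge T\ge1$ be integers, $\varepsilon\in\{1/T,2/T,\dots,1\}$ and $N=T+(n-T)|E|$. Fix $n$-element sets $L_e\subseteq[N]$ ($e\in E$) that contain $[T]$, have pairwise intersections $L_a\cap L_b=[T]$ ($a\ne b$) and cover $[N]$, and fix bijections $\rho_e:[n]\to L_e$ that are the identity on $[T]$. An instance consists of strings $X=(x_e)_{e\in E}$, $x_e\in\{0,1\}^n$, permutations $\Pi=((\pi_e)_{e\in E},(\pi_v)_{v\in V})$, with $\pi_e$ a permutation of $L_e$ and $\pi_v$ a permutation of $[N]$, and $\tau\in\{0^{\varepsilon T},1^{\varepsilon T}\}$, subject to the promise $\bigoplus_{e\in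 E}x_e^{1:\varepsilon T}=\tau$, where $x^{1:k}$ denotes the first $k$ bits of $x$. There is one player for each $e\in E$. Player $e$ sees the string $x_e\rho_e\pi_e\in\{0,1\}^{L_e}$, whose entry at position $\pi_e(\rho_e(j))$ is the $j$-th bit of $x_e$, and the values $(\pi_v(\pi_e^{-1}(i)))_{v\in e,\,i\in L_e}$. Players are deterministic, and each sends one message, a bit string determined by what that player sees, to a referee, who sees $\Pi$ and all the messages; there is no other communication. **Input distribution.** $\tau$ is uniform on $\{0^{\varepsilon T},1^{\varepsilon T}\}$; given $\tau$, $X$ is uniform among the tuples of strings satisfying the promise; all permutations are uniform, independent of each other and of $(\tau,X)$. Let $p$ be the referee's posterior distribution of $\tau$ given $\Pi$ and the messages, and let $\nu$ be the uniform distribution on $\{0^{\varepsilon T},1^{\varepsilon T}\}$. **Theorem 5.1.** There is a constant $\gamma>0$, depending only on $H$, such that the following holds for all $n,T,\varepsilon$ as above with $\varepsilon T\le n/10$, all choices of $(L_e,\rho_e)_{e\in E}$, all $c\in\{1,\dots,n\}$ and all $0<\delta<1$. If on no input $(X,\Pi)$ to the game any player sends a message of more than $c$ bits, and $$c\le\gamma\,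 n\left(\frac{\delta^2}{\varepsilon T}\right)^{1/\mu},$$ then $$\mathbb E_{X,\Pi}\big[\|p-\nu\|_{TV}\big]\le\delta .$$ Moreover, under the same hypotheses, whatever function of $\Pi$ and the messages the referee uses to guess $\tau$, the guess is correct with probability at most $1/2+\delta$. -/

import Mathlib

open scoped ENNReal

/-- A multi-hypergraph with vertices `V` and edges labelled by `E`: each label carries a finite set
of vertices. Repeated edges and empty edges are allowed. -/
structure MultiHypergraph (V E : Type*) where
  ends : E → Finset V

namespace MultiHypergraph

variable {V E : Type*}

/-- Connected: there is a vertex, and any two vertices are joined by a path along edges. -/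
def Connected (H : MultiHypergraph V E) : Prop :=
  Nonempty V ∧
    ∀ u v : V, Relation.ReflTransGen (fun a b => ∃ e, a ∈ H.ends e ∧ b ∈ H.ends e) u v

/-- The `lam`-modified fractional vertex cover number `MVC_lam(H, w)`: the least cost
`∑ v, f v + lam * ∑ e, f e` of `f : V ∪ E → [0, ∞]` such that
`∑ v ∈ e, f v + f e ≥ w e` for every edge `e`. -/
noncomputable def mvc [Fintype V] [Fintype E] (H : MultiHypergraph V E) (lam : ℝ≥0∞)
    (w : E → ℝ≥0∞) : ℝ≥0∞ :=
  ⨅ (f : V ⊕ E → ℝ≥0∞) (_ : ∀ e, w e ≤ ∑ v ∈ H.ends e, f (Sum.inl v) + f (Sum.inr e)),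
    (∑ v, f (Sum.inl v) + lam * ∑ e, f (Sum.inr e))

end MultiHypergraph

namespace PromiseCounting

/-- The size `N = T + (n - T) |E|` of the ground set. -/
abbrev groundSize (E : Type*) [Fintype E] (n T : ℕ) : ℕ := T + (n - T) * Fintype.card E

/-- The fixed data of the game: `n`-element sets `L_e ⊆ [N]`, any two of which meet exactly in
`[T]`, which together cover `[N]`, and bijections `ρ_e : [n] → L_e` that are the identity
on `[T]`. Indices start at `0`, so `[T] = {i | i < T}`. -/
structure Layout (E : Type*) [Fintype E] (n T : ℕ) where
  block : E → Finset (Fin (groundSize E n T))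
  card_block : ∀ e, (block e).card = n
  core_mem : ∀ e (i : Fin (groundSize E n T)), (i : ℕ) < T → i ∈ block e
  inter : ∀ a b, a ≠ b → ∀ i, i ∈ block a → i ∈ block b → (i : ℕ) < T
  cover : ∀ i, ∃ e, i ∈ block e
  rho : ∀ e, Fin n ≃ block e
  rho_core : ∀ e (i : Fin n), (i : ℕ) < T → ((rho e i : Fin (groundSize E n T)) : ℕ) = i

/-- The strings `X = (x_e)`. Bits are elements of `ZMod 2`, so that addition is XOR. -/
abbrev Strings (E : Type*) (n : ℕ) := E → Fin n → ZMod 2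

/-- The promise `⨁_e x_e^{1:K} = b^K`, where `b^K ∈ {0^K, 1^K}` is encoded by the bit `b`. -/
def Promise {E : Type*} [Fintype E] {n : ℕ} (K : ℕ) (b : ZMod 2) (X : Strings E n) : Prop :=
  ∀ i : Fin n, (i : ℕ) < K → ∑ e, X e i = b

section Game

variable {V E : Type*} [Fintype V] [Fintype E] {n T : ℕ}

/-- The permutations `Π = (Π_E, Π_V)`: `π_e` permutes `L_e`, and `π_v` permutes `[N]`. -/
abbrev Perms (V : Type*) (G : Layout E n T) :=
  ((e : E) → Equiv.Perm (G.block e)) × (V → Equiv.Perm (Fin (groundSize E n T)))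

/-- What a player `e` sees: a string in `{0,1}^{L_e}` and a family indexed by `v ∈ e`, `i ∈ L_e`. -/
abbrev PlayerInput (H : MultiHypergraph V E) (G : Layout E n T) (e : E) :=
  (G.block e → ZMod 2) × (H.ends e → G.block e → Fin (groundSize E n T))

/-- The input of player `e`: the string `x_e ρ_e π_e`, whose entry at position
`π_e (ρ_e j)` is the `j`-th bit of `x_e`, and the family `π_v (π_e⁻¹ i)`. -/
def playerInput (H : MultiHypergraph V E) (G : Layout E n T) (X : Strings E n) (P : Perms V G)
    (e : E) : PlayerInput H G e :=
  (fun i => X e ((G.rho e).symm ((P.1 e).symm i)),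
    fun v i => P.2 v ((P.1 e).symm i : G.block e))

/-- A deterministic protocol: each player maps its input to a message, a finite bit string. -/
abbrev Protocol (H : MultiHypergraph V E) (G : Layout E n T) :=
  (e : E) → PlayerInput H G e → List Bool

/-- What the referee sees: the permutations and all the messages. -/
abbrev View (V : Type*) (G : Layout E n T) := Perms V G × (E → List Bool)

/-- An outcome of the random experiment: the bit of `τ`, the strings, and the permutations. -/
abbrev Outcome (V : Type*) (G : Layout E n T) := ZMod 2 × Strings E n × Perms V G

def view {H : MultiHypergraph V E} {G : Layout E n T} (m : Protocol H G) (ω : Outcome V G) :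
    View V G :=
  (ω.2.2, fun e => m e (playerInput H G ω.2.1 ω.2.2 e))

open Classical in
/-- The probability of an outcome under the hard distribution: `τ` is uniform, given `τ` the
strings are uniform among those that satisfy the promise for `τ`, and the permutations are uniform
and independent of all the rest. -/
noncomputable def hardMass (G : Layout E n T) (K : ℕ) (ω : Outcome V G) : ℝ :=
  if Promise K ω.1 ω.2.1 then
    (1 / 2) * (1 / (Nat.card {X : Strings E n // Promise K ω.1 X} : ℝ)) *
      (1 / (Nat.card (Perms V G) : ℝ))
  else 0

open Classical in
/-- Expectation under the hard distribution. -/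
noncomputable def hardExp (G : Layout E n T) (K : ℕ) (f : Outcome V G → ℝ) : ℝ :=
  ∑ ω : Outcome V G, hardMass G K ω * f ω

open Classical in
/-- Probability under the hard distribution. -/
noncomputable def hardProb (G : Layout E n T) (K : ℕ) (A : Outcome V G → Prop) : ℝ :=
  hardExp G K (fun ω => if A ω then 1 else 0)

/-- The posterior probability that `τ = b^K` when the referee sees `r`. -/
noncomputable def posterior {H : MultiHypergraph V E} {G : Layout E n T} (K : ℕ)
    (m : Protocol H G) (r : View V G) (b : ZMod 2) : ℝ :=
  hardProb G K (fun ω => ω.1 = b ∧ view m ω = r) / hardProb G K (fun ω => view m ω = r)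

/-- The total variation distance between `p` and the uniform distribution on the two values
of `τ`. -/
noncomputable def tvUniform (p : ZMod 2 → ℝ) : ℝ := (1 / 2) * ∑ b, |p b - 1 / 2|

end Game

end PromiseCounting

/-! The proof computes the second moment of the referee's bias. Write K = εT. By the Walsh expansion
of the promise, the joint law for τ = 0 minus that for τ = 1 has density `signedDensity`, the sum of
∏_e χ_S(x_e) over odd-size S ⊆ [K]. Both conclusions reduce to `advantage`, which is half the mean
absolute conditional expectation of this density given the view (`advantage_eq`). Given Π, the
fibres of the messages are products, so squaring produces the terms E_Π ∏_e corr_e(S,T'), where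
corr_e(S,T') correlates the conditional expectations of χ_S and χ_T' given the message of e.

For one such term, LP duality supplies a fractional matching y with y_e ≤ 1/2 and total M ≥ μ
(`exists_fractional_matching`). With (π_v) fixed, the π_e are independent, so averaging over them
gives a product of factors of size at most F_e^(1/2) ≤ F_e^(y_e), with F_e the mean square. As F_e
depends only on the π_v with v ∈ e, `finner` separates the edges. In the mean of F_e, the uniform
(π_v) absorb π_e (`playerMessage_eq`), and π_e survives only as a uniform placement of the pair
(S,T').

Each averaged square is small because a c-bit message says little about characters.
Hypercontractivity gives the level-s inequality `sum_corr_self_le`, Bessel gives ∑_T corr(S,T)² ≤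
corr(S,S), and random placement spreads this weight over all sets of one size (`avgSq_le`,
`sum_sum_avgSq_le`). Using a pointwise bound for M - 1 of the M powers and a summed bound for the
last, the sum over sizes becomes geometric (`sum_sum_rpow_le`). Hence `advantage`² ≤ 2K(12c/n)^M,
which the hypothesis on c makes at most δ². -/

namespace BooleanCube

/-! ### Walsh characters and Bessel's inequality -/

open Finset
open scoped BigOperators

variable {ι : Type*}

/-- The character `(-1)^a` of `ZMod 2`. -/
def sgn (a : ZMod 2) : ℝ := if a = 0 then 1 else -1

@[simp] lemma sgn_zero : sgn 0 = 1 := by simp [sgn]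

@[simp] lemma sgn_one : sgn 1 = -1 := by simp [sgn]

lemma zmod_two_cases (a : ZMod 2) : a = 0 ∨ a = 1 := by
  revert a; decide

lemma sgn_add (a b : ZMod 2) : sgn (a + b) = sgn a * sgn b := by
  have h : (1 : ZMod 2) + 1 = 0 := by decide
  rcases zmod_two_cases a with rfl | rfl <;> rcases zmod_two_cases b with rfl | rfl <;> simp [h]

lemma sgn_mul_self (a : ZMod 2) : sgn a * sgn a = 1 := by
  rcases zmod_two_cases a with rfl | rfl <;> simp

lemma abs_sgn (a : ZMod 2) : |sgn a| = 1 := by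
  rcases zmod_two_cases a with rfl | rfl <;> simp

lemma sgn_sum {κ : Type*} (s : Finset κ) (f : κ → ZMod 2) :
    sgn (∑ i ∈ s, f i) = ∏ i ∈ s, sgn (f i) := by
  classical
  induction s using Finset.induction_on with
  | empty => simp
  | insert a s ha ih => rw [sum_insert ha, prod_insert ha, sgn_add, ih]

/-- The Walsh character of the cube indexed by the set `S`. -/
def chi (S : Finset ι) (x : ι → ZMod 2) : ℝ := ∏ i ∈ S, sgn (x i)

@[simp] lemma chi_empty (x : ι → ZMod 2) : chi ∅ x = 1 := by simp [chi]

lemma chi_mul_self (S : Finset ι) (x : ι → ZMod 2) : chi S x * chi S x = 1 := by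
  rw [chi, ← prod_mul_distrib]
  exact prod_eq_one fun i _ => sgn_mul_self _

lemma abs_chi (S : Finset ι) (x : ι → ZMod 2) : |chi S x| = 1 := by
  rw [chi, abs_prod]
  exact prod_eq_one fun i _ => abs_sgn _

lemma chi_map {κ : Type*} (τ : ι ≃ κ) (S : Finset ι) (y : κ → ZMod 2) :
    chi (S.map τ.toEmbedding) y = chi S (y ∘ τ) := by
  simp [chi]

variable [DecidableEq ι]

lemma chi_insert {S : Finset ι} {i : ι} (hi : i ∉ S) (x : ι → ZMod 2) :
    chi (insert i S) x = sgn (x i) * chi S x := by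
  rw [chi, prod_insert hi, chi]

lemma chi_flip_of_notMem {S : Finset ι} {i : ι} (hi : i ∉ S) (x : ι → ZMod 2) :
    chi S (x + Pi.single i 1) = chi S x := by
  refine prod_congr rfl fun j hj => ?_
  have : j ≠ i := by rintro rfl; exact hi hj
  simp [this]

lemma chi_flip_of_mem {S : Finset ι} {i : ι} (hi : i ∈ S) (x : ι → ZMod 2) :
    chi S (x + Pi.single i 1) = - chi S x := by
  rw [← insert_erase hi, chi_insert (notMem_erase i S), chi_insert (notMem_erase i S),
    chi_flip_of_notMem (notMem_erase i S)]
  simp [sgn_add]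

variable [Fintype ι]

lemma expect_eq_zero_of_flip (i : ι) (f : (ι → ZMod 2) → ℝ)
    (hf : ∀ x, f (x + Pi.single i 1) = - f x) : 𝔼 x, f x = 0 := by
  have h : 𝔼 x, f x = 𝔼 x, f (x + Pi.single i 1) :=
    (Fintype.expect_equiv (Equiv.addRight (Pi.single i 1)) _ _ fun x => rfl).symm
  simp only [hf, expect_neg_distrib] at h
  linarith

lemma expect_chi_mul_chi (S T : Finset ι) :
    𝔼 x : ι → ZMod 2, chi S x * chi T x = if S = T then 1 else 0 := by
  split_ifs with h
  · subst h
    simp [chi_mul_self]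
  · obtain ⟨i, hi⟩ : ∃ i, ¬ (i ∈ S ↔ i ∈ T) := by
      by_contra! hc
      exact h (Finset.ext hc)
    refine expect_eq_zero_of_flip i _ fun x => ?_
    by_cases hS : i ∈ S <;> by_cases hT : i ∈ T
    · exact absurd (iff_of_true hS hT) hi
    · rw [chi_flip_of_mem hS, chi_flip_of_notMem hT]; ring
    · rw [chi_flip_of_notMem hS, chi_flip_of_mem hT]; ring
    · exact absurd (iff_of_false hS hT) hi

lemma expect_chi (S : Finset ι) : 𝔼 x : ι → ZMod 2, chi S x = if S = ∅ then 1 else 0 := by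
  rw [← expect_chi_mul_chi S ∅]
  simp

/-- Bessel's inequality for the Walsh characters. -/
lemma bessel (φ : (ι → ZMod 2) → ℝ) :
    ∑ S : Finset ι, (𝔼 x, φ x * chi S x) ^ 2 ≤ 𝔼 x, φ x ^ 2 := by
  set a : Finset ι → ℝ := fun S => 𝔼 x, φ x * chi S x with ha
  have h1 : 𝔼 x, φ x * ∑ S, a S * chi S x = ∑ S, a S ^ 2 := by
    simp only [mul_sum]
    rw [expect_sum_comm]
    refine sum_congr rfl fun S _ => ?_
    rw [pow_two, ha, mul_expect]
    exact expect_congr rfl fun x _ => by ring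
  have h2 : 𝔼 x, (∑ S, a S * chi S x) ^ 2 = ∑ S, a S ^ 2 := by
    simp only [pow_two, sum_mul_sum]
    rw [expect_sum_comm]
    refine sum_congr rfl fun S _ => ?_
    rw [expect_sum_comm]
    have : ∀ T, 𝔼 x, a S * chi S x * (a T * chi T x) = if S = T then a S * a T else 0 := by
      intro T
      rw [show (if S = T then a S * a T else 0) = a S * a T * (if S = T then 1 else 0) by simp,
        ← expect_chi_mul_chi, mul_expect]
      exact expect_congr rfl fun x _ => by ring
    simp [this]
  have h3 : 0 ≤ 𝔼 x, (φ x - ∑ S, a S * chi S x) ^ 2 := expect_nonneg fun x _ => sq_nonneg _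
  have h4 : 𝔼 x, (φ x - ∑ S, a S * chi S x) ^ 2 =
      𝔼 x, φ x ^ 2 - 2 * 𝔼 x, φ x * ∑ S, a S * chi S x + 𝔼 x, (∑ S, a S * chi S x) ^ 2 := by
    rw [mul_expect, ← expect_sub_distrib, ← expect_add_distrib]
    exact expect_congr rfl fun x _ => by ring
  rw [h4, h1, h2] at h3
  linarith

/-! ### Hypercontractivity on the cube -/

lemma choose_two_mul_le (k j : ℕ) (hj : j ≤ k) :
    ((2 * k).choose (2 * j) : ℝ) ≤ (2 * k - 1) ^ j * k.choose j := by
  induction j with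
  | zero => simp
  | succ j ih =>
    have ih := ih (by omega)
    have h1 : ((2 * k).choose (2 * j + 1) : ℝ) * (2 * j + 1) =
        (2 * k).choose (2 * j) * (2 * k - 2 * j) := by
      have := Nat.choose_succ_right_eq (2 * k) (2 * j)
      have h : ((2 * k - 2 * j : ℕ) : ℝ) = 2 * k - 2 * j := by
        rw [Nat.cast_sub (by omega)]; push_cast; ring
      rw [← h]; exact_mod_cast this
    have h2 : ((2 * k).choose (2 * (j + 1)) : ℝ) * (2 * j + 2) =
        (2 * k).choose (2 * j + 1) * (2 * k - 2 * j - 1) := by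
      have := Nat.choose_succ_right_eq (2 * k) (2 * j + 1)
      have h : ((2 * k - (2 * j + 1) : ℕ) : ℝ) = 2 * k - 2 * j - 1 := by
        rw [Nat.cast_sub (by omega)]; push_cast; ring
      rw [← h]; exact_mod_cast this
    have h3 : (k.choose (j + 1) : ℝ) * (j + 1) = k.choose j * (k - j) := by
      have := Nat.choose_succ_right_eq k j
      have h : ((k - j : ℕ) : ℝ) = k - j := by rw [Nat.cast_sub (by omega)]
      rw [← h]; exact_mod_cast this
    have hjk : (j : ℝ) + 1 ≤ k := by exact_mod_cast hj
    have hj0 : (0 : ℝ) ≤ j := by positivity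
    set A : ℝ := (((2 * k).choose (2 * j) : ℕ) : ℝ)
    set D : ℝ := (((2 * k).choose (2 * (j + 1)) : ℕ) : ℝ)
    set B : ℝ := ((k.choose j : ℕ) : ℝ)
    set C : ℝ := ((k.choose (j + 1) : ℕ) : ℝ)
    have hC : 0 ≤ C := by positivity
    have hA : 0 ≤ A := by positivity
    have hp : 0 ≤ (2 * (k : ℝ) - 1) ^ j := pow_nonneg (by linarith) _
    have h4 : D * ((2 * j + 2) * (2 * j + 1)) = A * (2 * k - 2 * j) * (2 * k - 2 * j - 1) := by
      linear_combination (2 * (j : ℝ) + 1) * h2 + (2 * (k : ℝ) - 2 * j - 1) * h1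
    have h5 : A * (2 * k - 2 * j) ≤ (2 * k - 1) ^ j * (C * (2 * j + 2)) := by
      have : (2 * (k : ℝ) - 1) ^ j * (C * (2 * j + 2)) =
        (2 * (k : ℝ) - 1) ^ j * B * (2 * k - 2 * j) := by
        linear_combination 2 * (2 * (k : ℝ) - 1) ^ j * h3
      rw [this]
      exact mul_le_mul_of_nonneg_right ih (by linarith)
    -- The step from j to j + 1 only needs 2k - 2j - 1 ≤ (2k - 1)(2j + 1).
    have h6 : D * ((2 * j + 2) * (2 * j + 1)) ≤
        (2 * k - 1) ^ (j + 1) * C * ((2 * j + 2) * (2 * j + 1)) := by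
      rw [h4]
      calc _ ≤ (2 * k - 1) ^ j * (C * (2 * j + 2)) * (2 * k - 2 * j - 1) :=
            mul_le_mul_of_nonneg_right h5 (by linarith)
        _ ≤ (2 * k - 1) ^ j * (C * (2 * j + 2)) * ((2 * k - 1) * (2 * j + 1)) := by
            refine mul_le_mul_of_nonneg_left ?_ (by positivity)
            nlinarith
        _ = _ := by ring
    exact le_of_mul_le_mul_right h6 (by positivity)

lemma pow_mul_pow_le_weighted {a b : ℝ} (ha : 0 ≤ a) (hb : 0 ≤ b) {k j : ℕ} (hk : 0 < k)
    (hj : j ≤ k) :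
    a ^ j * b ^ (k - j) ≤ (j / k : ℝ) * a ^ k + ((k - j : ℕ) / k : ℝ) * b ^ k := by
  have hk' : (k : ℝ) ≠ 0 := by positivity
  have h := Real.geom_mean_le_arith_mean2_weighted (w₁ := j / k) (w₂ := (k - j : ℕ) / k)
    (p₁ := a ^ k) (p₂ := b ^ k) (by positivity) (by positivity) (by positivity) (by positivity)
    (by rw [Nat.cast_sub hj]; field_simp; ring)
  have e : ∀ (c : ℝ) (_ : 0 ≤ c) (i : ℕ), (c ^ k) ^ (i / k : ℝ) = c ^ i := by
    intro c hc i
    rw [← Real.rpow_natCast, ← Real.rpow_mul hc, mul_div_cancel₀ _ hk', Real.rpow_natCast]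
  rwa [e a ha, e b hb] at h

/-- Hölder's inequality for mixed moments with integer exponents. -/
lemma expect_pow_mul_pow_le {X : Type*} [Fintype X] [Nonempty X] (u v : X → ℝ) (hu : ∀ x, 0 ≤ u x)
    (hv : ∀ x, 0 ≤ v x) {α β : ℝ} (hα : 0 ≤ α) (hβ : 0 ≤ β) {k : ℕ}
    (hu' : 𝔼 x, u x ^ k ≤ α ^ k) (hv' : 𝔼 x, v x ^ k ≤ β ^ k) {j : ℕ} (hj : j ≤ k) :
    𝔼 x, u x ^ j * v x ^ (k - j) ≤ α ^ j * β ^ (k - j) := by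
  have zero : ∀ (w : X → ℝ), (∀ x, 0 ≤ w x) → 0 < k → 𝔼 x, w x ^ k ≤ (0 : ℝ) ^ k →
      ∀ x, w x = 0 := by
    intro w hw hk h x
    rw [zero_pow hk.ne'] at h
    have h0 := (Finset.expect_eq_zero_iff_of_nonneg
      fun x _ => pow_nonneg (hw x) k).1 (le_antisymm h (expect_nonneg fun x _ => pow_nonneg (hw x) k))
    exact pow_eq_zero_iff hk.ne' |>.1 (h0 x (mem_univ x))
  rcases Nat.eq_zero_or_pos j with rfl | hj0
  · simpa using hv'
  rcases hj.eq_or_lt with rfl | hjk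
  · simpa using hu'
  have hk : 0 < k := by omega
  rcases hα.eq_or_lt with rfl | hα
  · simp [zero u hu hk hu', hj0.ne']
  rcases hβ.eq_or_lt with rfl | hβ
  · simp [zero v hv hk hv', (show k - j ≠ 0 by omega)]
  -- Normalise both functions and apply weighted AM-GM pointwise; the cases α = 0 and β = 0 had to
  -- be removed first.
  have key : ∀ x, (u x / α) ^ j * (v x / β) ^ (k - j) ≤
      (j / k : ℝ) * (u x / α) ^ k + ((k - j : ℕ) / k : ℝ) * (v x / β) ^ k := fun x =>
    pow_mul_pow_le_weighted (div_nonneg (hu x) hα.le) (div_nonneg (hv x) hβ.le) hk hj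
  have h1 := expect_le_expect (s := univ) fun x _ => key x
  rw [expect_add_distrib, ← mul_expect, ← mul_expect] at h1
  simp only [div_pow, ← expect_div] at h1
  have h2 : (𝔼 x, u x ^ k) / α ^ k ≤ 1 := (div_le_one (by positivity)).2 hu'
  have h3 : (𝔼 x, v x ^ k) / β ^ k ≤ 1 := (div_le_one (by positivity)).2 hv'
  have h4 : (𝔼 x, u x ^ j / α ^ j * (v x ^ (k - j) / β ^ (k - j))) ≤ 1 := by
    refine h1.trans ?_
    calc _ ≤ (j / k : ℝ) * 1 + ((k - j : ℕ) / k : ℝ) * 1 := by gcongr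
      _ = 1 := by rw [Nat.cast_sub hj]; field_simp; ring
  have h5 : (𝔼 x, u x ^ j / α ^ j * (v x ^ (k - j) / β ^ (k - j))) =
      (𝔼 x, u x ^ j * v x ^ (k - j)) / (α ^ j * β ^ (k - j)) := by
    rw [expect_div]
    exact expect_congr rfl fun x _ => by rw [div_mul_div_comm]
  rw [h5, div_le_one (by positivity)] at h4
  exact h4

lemma sum_range_two_mul_add_one {f : ℕ → ℝ} (hf : ∀ j, f (2 * j + 1) = 0) (k : ℕ) :
    ∑ i ∈ range (2 * k + 1), f i = ∑ j ∈ range (k + 1), f (2 * j) := by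
  induction k with
  | zero => simp
  | succ k ih =>
    rw [show 2 * (k + 1) + 1 = 2 * k + 1 + 1 + 1 by ring, sum_range_succ, sum_range_succ, ih,
      sum_range_succ _ (k + 1), hf, add_zero, show 2 * k + 1 + 1 = 2 * (k + 1) by ring]

/-- The `(2, 2k)` hypercontractive inequality on the cube. -/
lemma expect_pow_le_of_powerset {k : ℕ} (hk : 0 < k) (J : Finset ι) (b : Finset ι → ℝ) :
    𝔼 x, (∑ S ∈ J.powerset, b S * chi S x) ^ (2 * k) ≤
      (∑ S ∈ J.powerset, (2 * k - 1 : ℝ) ^ #S * b S ^ 2) ^ k := by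
  have hk1 : (1 : ℝ) ≤ k := by exact_mod_cast hk
  have hr : (0 : ℝ) ≤ 2 * k - 1 := by linarith
  induction J using Finset.induction_on generalizing b with
  | empty => simp [pow_mul]
  | insert i J hi ih =>
    set F : (ι → ZMod 2) → ℝ := fun x => ∑ S ∈ J.powerset, b S * chi S x with hF
    set G : (ι → ZMod 2) → ℝ := fun x => ∑ S ∈ J.powerset, b (insert i S) * chi S x with hG
    set α : ℝ := ∑ S ∈ J.powerset, (2 * k - 1 : ℝ) ^ #S * b S ^ 2 with hα
    set β : ℝ := ∑ S ∈ J.powerset, (2 * k - 1 : ℝ) ^ #S * b (insert i S) ^ 2 with hβ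
    have hnot : ∀ S ∈ J.powerset, i ∉ S := fun S hS h => hi (mem_powerset.1 hS h)
    -- Split by i ∈ S: the polynomial is x_i G + F with F and G free of x_i, so odd powers of x_i
    -- average to zero.
    have e1 : ∀ x, ∑ S ∈ (insert i J).powerset, b S * chi S x = sgn (x i) * G x + F x := by
      intro x
      rw [sum_powerset_insert hi, add_comm, hG]
      simp only [mul_sum]
      congr 1
      refine sum_congr rfl fun S hS => ?_
      rw [chi_insert (hnot S hS)]; ring
    have e2 : ∑ S ∈ (insert i J).powerset, (2 * k - 1 : ℝ) ^ #S * b S ^ 2 =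
        (2 * k - 1) * β + α := by
      rw [sum_powerset_insert hi, add_comm, hβ, mul_sum]
      congr 1
      refine sum_congr rfl fun S hS => ?_
      rw [card_insert_of_notMem (hnot S hS)]; ring
    have hFf : ∀ x, F (x + Pi.single i 1) = F x := fun x =>
      sum_congr rfl fun S hS => by rw [chi_flip_of_notMem (hnot S hS)]
    have hGf : ∀ x, G (x + Pi.single i 1) = G x := fun x =>
      sum_congr rfl fun S hS => by rw [chi_flip_of_notMem (hnot S hS)]
    have hα0 : 0 ≤ α := sum_nonneg fun S _ => by positivity
    have hβ0 : 0 ≤ β := sum_nonneg fun S _ => by positivity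
    simp only [e1, e2, add_pow]
    rw [expect_sum_comm, sum_range_two_mul_add_one]
    · refine sum_le_sum fun j hj => ?_
      have hjk : j ≤ k := by have := mem_range.1 hj; omega
      have e3 : ∀ x, (sgn (x i) * G x) ^ (2 * j) * F x ^ (2 * k - 2 * j) *
          ((2 * k).choose (2 * j) : ℝ) =
          (G x ^ 2) ^ j * (F x ^ 2) ^ (k - j) * ((2 * k).choose (2 * j) : ℝ) := by
        intro x
        rw [mul_pow, pow_mul (sgn (x i)), pow_two (sgn (x i)), sgn_mul_self, one_pow, one_mul,
          pow_mul, ← pow_mul (F x), Nat.mul_sub]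
      simp only [e3]
      rw [← expect_mul]
      -- Hölder and induction bound the mixed moments by β^j α^(k-j); the binomial comparison then
      -- reassembles ((2k-1)β + α)^k.
      have h1 := expect_pow_mul_pow_le (fun x => G x ^ 2) (fun x => F x ^ 2)
        (fun x => sq_nonneg _) (fun x => sq_nonneg _) hβ0 hα0 (k := k) (j := j)
        (by simpa only [← pow_mul] using ih fun S => b (insert i S))
        (by simpa only [← pow_mul] using ih b) hjk
      calc _ ≤ β ^ j * α ^ (k - j) * ((2 * k - 1) ^ j * k.choose j) := by
            gcongr
            exact choose_two_mul_le k j hjk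
        _ = _ := by rw [mul_pow]; ring
    · intro j
      refine expect_eq_zero_of_flip i _ fun x => ?_
      have : sgn ((x + Pi.single i 1 : ι → ZMod 2) i) = - sgn (x i) := by simp [sgn_add]
      rw [hFf, hGf, this, neg_mul, Odd.neg_pow ⟨j, rfl⟩]
      ring

lemma expect_pow_le_of_card {k : ℕ} (hk : 0 < k) (s : ℕ) (b : Finset ι → ℝ) :
    𝔼 x, (∑ S ∈ univ.powersetCard s, b S * chi S x) ^ (2 * k) ≤
      ((2 * k - 1 : ℝ) ^ s * ∑ S ∈ (univ : Finset ι).powersetCard s, b S ^ 2) ^ k := by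
  have h := expect_pow_le_of_powerset hk (univ : Finset ι) (fun S => if #S = s then b S else 0)
  have e : ∀ f : Finset ι → ℝ, ∑ S ∈ univ.powersetCard s, f S =
      ∑ S ∈ (univ : Finset ι).powerset, if #S = s then f S else 0 := by
    intro f
    rw [← sum_filter]
    exact sum_congr (by ext; simp [mem_powersetCard]) fun _ _ => rfl
  convert h using 3 with x
  · rw [e]
    exact sum_congr rfl fun S _ => by split_ifs <;> simp
  · rw [e, mul_sum]
    exact sum_congr rfl fun S _ => by split_ifs with hS <;> simp [hS]

/-! ### Conditional expectation given a message -/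

section CondAvg

variable {X Y β : Type*} [Fintype X] [Fintype Y]

open Classical in
/-- The conditional expectation of `φ` given the value of `m`, under the uniform distribution. -/
noncomputable def condAvg (m : X → β) (φ : X → ℝ) (y : X) : ℝ :=
  𝔼 x ∈ univ.filter (fun x => m x = m y), φ x

open Classical in
lemma fiber_nonempty (m : X → β) (y : X) : (univ.filter fun x => m x = m y).Nonempty :=
  ⟨y, by simp⟩

lemma condAvg_congr (m : X → β) (φ : X → ℝ) {y z : X} (h : m y = m z) :
    condAvg m φ y = condAvg m φ z := by
  unfold condAvg
  rw [h]

lemma sum_condAvg (m : X → β) (φ : X → ℝ) : ∑ y, condAvg m φ y = ∑ y, φ y := by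
  classical
  simp only [condAvg, expect_eq_sum_div_card, sum_filter, sum_div]
  rw [sum_comm]
  refine sum_congr rfl fun x _ => ?_
  have hpos : (0 : ℝ) < #(univ.filter fun z => m z = m x) := by
    exact_mod_cast (fiber_nonempty m x).card_pos
  calc ∑ y, (if m x = m y then φ x else 0) / (#(univ.filter fun z => m z = m y) : ℝ)
      = ∑ y, if m y = m x then φ x / (#(univ.filter fun z => m z = m x) : ℝ) else 0 := by
        refine sum_congr rfl fun y _ => ?_
        by_cases h : m x = m y
        · simp [h]
        · simp [h, Ne.symm h]
    _ = φ x := by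
        rw [← sum_filter, sum_const, nsmul_eq_mul]
        field_simp

lemma expect_condAvg (m : X → β) (φ : X → ℝ) : 𝔼 y, condAvg m φ y = 𝔼 y, φ y := by
  simp only [Fintype.expect_eq_sum_div_card, sum_condAvg]

lemma condAvg_mul_of_const (m : X → β) (φ ψ : X → ℝ)
    (hφ : ∀ x y, m x = m y → φ x = φ y) (y : X) :
    condAvg m (fun x => φ x * ψ x) y = φ y * condAvg m ψ y := by
  classical
  rw [condAvg, condAvg, mul_expect]
  refine expect_congr rfl fun x hx => ?_
  rw [hφ x y (mem_filter.1 hx).2]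

lemma expect_condAvg_mul_condAvg (m : X → β) (φ ψ : X → ℝ) :
    𝔼 y, condAvg m φ y * condAvg m ψ y = 𝔼 y, condAvg m φ y * ψ y := by
  rw [← expect_condAvg m fun y => condAvg m φ y * ψ y]
  refine expect_congr rfl fun y _ => ?_
  rw [condAvg_mul_of_const m _ _ fun x y h => condAvg_congr m φ h]

lemma abs_condAvg_le_one (m : X → β) (φ : X → ℝ) (hφ : ∀ x, |φ x| ≤ 1) (y : X) :
    |condAvg m φ y| ≤ 1 := by
  classical
  exact (abs_expect_le _ _).trans (expect_le (fiber_nonempty m y) fun x _ => hφ x)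

lemma condAvg_comp_equiv (e : X ≃ Y) (m : Y → β) (φ : Y → ℝ) (x : X) :
    condAvg (fun x => m (e x)) (fun x => φ (e x)) x = condAvg m φ (e x) := by
  classical
  exact expect_equiv e (by simp) fun i _ => rfl

end CondAvg

lemma expect_pow_le_expect_pow {X : Type*} {s : Finset X} (hs : s.Nonempty) (f : X → ℝ) {n : ℕ}
    (h : Even n ∨ ∀ x, 0 ≤ f x) : (𝔼 x ∈ s, f x) ^ n ≤ 𝔼 x ∈ s, f x ^ n := by
  have hc : (0 : ℝ) < #s := by exact_mod_cast hs.card_pos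
  have hw : ∑ _x ∈ s, (1 / #s : ℝ) = 1 := by
    rw [sum_const, nsmul_eq_mul]; field_simp
  have e : ∀ g : X → ℝ, 𝔼 x ∈ s, g x = ∑ x ∈ s, (1 / #s : ℝ) * g x := fun g => by
    rw [expect_eq_sum_div_card, sum_div]
    exact sum_congr rfl fun x _ => by ring
  rw [e, e]
  rcases h with h | h
  · exact Real.pow_arith_mean_le_arith_mean_pow_of_even s _ _ (fun _ _ => by positivity) hw h
  · exact Real.pow_arith_mean_le_arith_mean_pow s _ _ (fun _ _ => by positivity) hw
      (fun x _ => h x) n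

/-! ### Correlations of characters and the level-s inequality -/

section Corr

variable {ι β : Type*} [Fintype ι] [DecidableEq ι]

/-- The correlation of the conditional expectations of two characters given `m`. -/
noncomputable def corr (m : (ι → ZMod 2) → β) (S T : Finset ι) : ℝ :=
  𝔼 y, condAvg m (chi S) y * condAvg m (chi T) y

lemma corr_comm (m : (ι → ZMod 2) → β) (S T : Finset ι) : corr m S T = corr m T S :=
  expect_congr rfl fun _ _ => mul_comm _ _

lemma abs_corr_le_one (m : (ι → ZMod 2) → β) (S T : Finset ι) : |corr m S T| ≤ 1 := by
  refine (abs_expect_le _ _).trans (expect_le univ_nonempty fun y _ => ?_)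
  rw [abs_mul]
  exact mul_le_one₀ (abs_condAvg_le_one _ _ (fun x => (abs_chi S x).le) y) (abs_nonneg _)
    (abs_condAvg_le_one _ _ (fun x => (abs_chi T x).le) y)

lemma corr_sq_le_one (m : (ι → ZMod 2) → β) (S T : Finset ι) : corr m S T ^ 2 ≤ 1 :=
  (sq_le_one_iff_abs_le_one _).2 (abs_corr_le_one m S T)

lemma corr_self (m : (ι → ZMod 2) → β) (S : Finset ι) :
    corr m S S = 𝔼 y, condAvg m (chi S) y ^ 2 :=
  expect_congr rfl fun _ _ => (pow_two _).symm

/-- Conditional expectation is a self-adjoint projection, so corr(S,T) is the Walsh coefficient at T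
of the projected χ_S; Bessel applies, and the squared norm is corr(S,S). -/
lemma sum_corr_sq_le (m : (ι → ZMod 2) → β) (S : Finset ι) :
    ∑ T, corr m S T ^ 2 ≤ corr m S S := by
  rw [corr_self]
  refine le_trans (le_of_eq ?_) (bessel (condAvg m (chi S)))
  exact sum_congr rfl fun T _ => by rw [corr, expect_condAvg_mul_condAvg]

/-- Each nonempty fibre contributes exactly 1, so the sum counts fibres. -/
lemma sum_inv_card_fiber_le {X : Type*} [Fintype X] [DecidableEq β] (m : X → β) (R : Finset β)
    (hR : ∀ x, m x ∈ R) : ∑ y, (1 / #(univ.filter fun x => m x = m y) : ℝ) ≤ #R := by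
  rw [← sum_fiberwise_of_maps_to (t := R) fun x _ => hR x]
  refine (sum_le_card_nsmul R _ 1 fun r _ => ?_).trans (by simp)
  have : ∀ y ∈ univ.filter (fun x => m x = r), (1 / #(univ.filter fun x => m x = m y) : ℝ) =
      1 / #(univ.filter fun x => m x = r) := fun y hy => by rw [(mem_filter.1 hy).2]
  rw [sum_congr rfl this, sum_const, nsmul_eq_mul, mul_one_div]
  exact div_self_le_one _

-- Let w be the level-s weight at y and h = ∑ a_S χ_S, with a_S the conditional mean of χ_S. The
-- fibre average of h is w. Jensen, enlarging the fibre to the cube, and hypercontractivity bound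
-- w^(2k) by a multiple of w^k; cancel w^k.
open Classical in
lemma sum_condAvg_chi_sq_pow_le (m : (ι → ZMod 2) → β) {s k : ℕ} (hk : 0 < k)
    (y : ι → ZMod 2) :
    (∑ S ∈ univ.powersetCard s, condAvg m (chi S) y ^ 2) ^ k ≤
      Fintype.card (ι → ZMod 2) * ((2 * k - 1) ^ s) ^ k *
        (1 / #(univ.filter fun x => m x = m y)) := by
  have hk1 : (1 : ℝ) ≤ k := by exact_mod_cast hk
  have hc : (0 : ℝ) ≤ 2 * k - 1 := by linarith
  obtain ⟨w, hw⟩ : ∃ w, w = ∑ S ∈ univ.powersetCard s, condAvg m (chi S) y ^ 2 := ⟨_, rfl⟩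
  have hw0 : 0 ≤ w := by rw [hw]; exact sum_nonneg fun S _ => sq_nonneg _
  obtain ⟨M, hM⟩ : ∃ M : ℝ, M = Fintype.card (ι → ZMod 2) := ⟨_, rfl⟩
  have hM0 : 0 < M := by rw [hM]; exact_mod_cast Fintype.card_pos
  obtain ⟨N, hN⟩ : ∃ N : ℝ, N = #(univ.filter fun x => m x = m y) := ⟨_, rfl⟩
  have hN0 : 0 < N := by rw [hN]; exact_mod_cast (fiber_nonempty m y).card_pos
  obtain ⟨h, hh⟩ : ∃ h : (ι → ZMod 2) → ℝ, h = fun x =>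
    ∑ S ∈ univ.powersetCard s, condAvg m (chi S) y * chi S x := ⟨_, rfl⟩
  have h1 : condAvg m h y = w := by
    rw [condAvg, hh, expect_sum_comm, hw]
    exact sum_congr rfl fun S _ => by rw [← mul_expect, pow_two]; rfl
  have h2 : w ^ (2 * k) ≤ condAvg m (fun x => h x ^ (2 * k)) y := by
    rw [← h1]
    exact expect_pow_le_expect_pow (fiber_nonempty m y) h (Or.inl (even_two_mul k))
  have h3 : condAvg m (fun x => h x ^ (2 * k)) y ≤ M / N * 𝔼 x, h x ^ (2 * k) := by
    rw [condAvg, expect_eq_sum_div_card, Fintype.expect_eq_sum_div_card, ← hM, ← hN,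
      div_mul_div_comm, mul_comm N, mul_div_mul_left _ _ hM0.ne']
    refine div_le_div_of_nonneg_right ?_ hN0.le
    exact sum_le_sum_of_subset_of_nonneg (filter_subset _ _)
      fun x _ _ => (even_two_mul k).pow_nonneg _
  have h5 : 𝔼 x, h x ^ (2 * k) ≤ ((2 * k - 1) ^ s * w) ^ k := by
    rw [hh, hw]
    exact expect_pow_le_of_card hk s _
  have h4 : w ^ k * w ^ k ≤ M / N * ((2 * k - 1) ^ s) ^ k * w ^ k := by
    calc w ^ k * w ^ k = w ^ (2 * k) := by ring
      _ ≤ M / N * 𝔼 x, h x ^ (2 * k) := h2.trans h3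
      _ ≤ M / N * ((2 * k - 1) ^ s * w) ^ k := mul_le_mul_of_nonneg_left h5 (by positivity)
      _ = _ := by rw [mul_pow]; ring
  rw [← hw, ← hM, ← hN]
  rcases hw0.eq_or_lt with h0 | h0
  · rw [← h0, zero_pow hk.ne']; positivity
  · refine (le_of_mul_le_mul_right h4 (pow_pos h0 k)).trans (le_of_eq ?_)
    ring

/-- The level-`s` inequality: if `m` takes at most `2 ^ r` values, then the level-`s` Fourier weight
of its fibres is small on average. -/
lemma sum_corr_self_le (m : (ι → ZMod 2) → β) (R : Finset β) (hR : ∀ x, m x ∈ R) {r s k : ℕ}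
    (hRr : #R ≤ 2 ^ r) (hk : 0 < k) (hr : r ≤ s * k) :
    ∑ S ∈ univ.powersetCard s, corr m S S ≤ (2 * (2 * k - 1 : ℝ)) ^ s := by
  classical
  have hk1 : (1 : ℝ) ≤ k := by exact_mod_cast hk
  have hc : (0 : ℝ) ≤ 2 * k - 1 := by linarith
  obtain ⟨w, hw⟩ : ∃ w : (ι → ZMod 2) → ℝ, w = fun y =>
    ∑ S ∈ univ.powersetCard s, condAvg m (chi S) y ^ 2 := ⟨_, rfl⟩
  have hw0 : ∀ y, 0 ≤ w y := fun y => by rw [hw]; exact sum_nonneg fun S _ => sq_nonneg _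
  have hW : ∑ S ∈ univ.powersetCard s, corr m S S = 𝔼 y, w y := by
    simp only [corr_self, hw, expect_sum_comm]
  have hsum : ∑ y, (1 / #(univ.filter fun x => m x = m y) : ℝ) ≤ 2 ^ (s * k) := by
    refine (sum_inv_card_fiber_le m R hR).trans ?_
    calc (#R : ℝ) ≤ 2 ^ r := by exact_mod_cast hRr
      _ ≤ 2 ^ (s * k) := pow_le_pow_right₀ (by norm_num) hr
  -- Averaging over y turns the inverse fibre sizes into the number of fibres, at most 2^(sk); the
  -- k-th root then costs only 2^s.
  have hWk : (𝔼 y, w y) ^ k ≤ ((2 * (2 * k - 1 : ℝ)) ^ s) ^ k := by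
    calc (𝔼 y, w y) ^ k ≤ 𝔼 y, w y ^ k :=
          expect_pow_le_expect_pow univ_nonempty w (Or.inr hw0)
      _ ≤ 𝔼 y, (Fintype.card (ι → ZMod 2) : ℝ) * ((2 * k - 1) ^ s) ^ k *
            (1 / #(univ.filter fun x => m x = m y)) :=
          expect_le_expect fun y _ => by rw [hw]; exact sum_condAvg_chi_sq_pow_le m hk y
      _ = ((2 * k - 1) ^ s) ^ k * ∑ y, (1 / #(univ.filter fun x => m x = m y) : ℝ) := by
          have hM0 : (Fintype.card (ι → ZMod 2) : ℝ) ≠ 0 := by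
            exact_mod_cast Fintype.card_pos.ne'
          rw [← mul_expect, Fintype.expect_eq_sum_div_card, mul_assoc, mul_left_comm,
            mul_div_cancel₀ _ hM0]
      _ ≤ ((2 * k - 1) ^ s) ^ k * (2 : ℝ) ^ (s * k) :=
          mul_le_mul_of_nonneg_left hsum (by positivity)
      _ = _ := by rw [pow_mul, ← mul_pow, ← mul_pow, mul_comm]
  rw [hW]
  exact le_of_pow_le_pow_left₀ hk.ne' (by positivity) hWk

/-! ### Random placement of a pair of sets -/

lemma exists_perm_map_eq {S T : Finset ι} (h : #S = #T) :
    ∃ τ : Equiv.Perm ι, S.map τ.toEmbedding = T := by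
  refine ⟨(Finset.equivOfCardEq h).extendSubtype, ?_⟩
  refine eq_of_subset_of_card_le (fun i hi => ?_) (by rw [card_map, h])
  obtain ⟨j, hj, rfl⟩ := mem_map.1 hi
  exact Equiv.extendSubtype_mem _ j hj

/-- The image of a set under a uniform permutation is uniform among the sets of its size. -/
lemma expect_perm_map (S : Finset ι) (φ : Finset ι → ℝ) :
    𝔼 τ : Equiv.Perm ι, φ (S.map τ.toEmbedding) =
      (∑ U ∈ univ.powersetCard #S, φ U) / (Fintype.card ι).choose #S := by
  have h1 : ∀ U ∈ (univ : Finset ι).powersetCard #S,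
      𝔼 τ : Equiv.Perm ι, φ (U.map τ.toEmbedding) = 𝔼 τ : Equiv.Perm ι, φ (S.map τ.toEmbedding) := by
    intro U hU
    obtain ⟨σ, rfl⟩ := exists_perm_map_eq (mem_powersetCard.1 hU).2.symm
    refine Fintype.expect_equiv (Equiv.mulRight σ) _ _ fun τ => ?_
    rw [map_map]; rfl
  have h2 : ∀ τ : Equiv.Perm ι, ∑ U ∈ univ.powersetCard #S, φ (U.map τ.toEmbedding) =
      ∑ U ∈ univ.powersetCard #S, φ U := by
    intro τ
    refine sum_bij' (fun U _ => U.map τ.toEmbedding) (fun U _ => U.map τ.symm.toEmbedding)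
      ?_ ?_ ?_ ?_ ?_ <;> simp +contextual [mem_powersetCard, map_map]
  have h3 := sum_congr rfl h1
  rw [← expect_sum_comm, expect_congr rfl fun τ _ => h2 τ, Fintype.expect_const, sum_const,
    card_powersetCard, nsmul_eq_mul] at h3
  have hpos : (0 : ℝ) < (Fintype.card ι).choose #S := by
    exact_mod_cast Nat.choose_pos (card_le_univ S)
  rw [h3]
  exact (mul_div_cancel_left₀ _ hpos.ne').symm

lemma corr_comp_perm (m : (ι → ZMod 2) → β) (τ : Equiv.Perm ι) (S T : Finset ι) :
    corr (fun x => m (x ∘ τ.symm)) S T = corr m (S.map τ.toEmbedding) (T.map τ.toEmbedding) := by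
  have h : ∀ (U : Finset ι) (x : ι → ZMod 2), condAvg (fun x => m (x ∘ τ.symm)) (chi U) x =
      condAvg m (chi (U.map τ.toEmbedding)) (x ∘ τ.symm) := by
    intro U x
    have := condAvg_comp_equiv (τ.arrowCongr (Equiv.refl (ZMod 2))) m
      (chi (U.map τ.toEmbedding)) x
    refine Eq.trans ?_ this
    congr 1
    ext x
    rw [chi_map]
    congr 1
    ext i
    simp [Equiv.arrowCongr]
  exact Fintype.expect_equiv (τ.arrowCongr (Equiv.refl (ZMod 2))) _ _ fun x => by
    rw [h, h]; rfl

/-- The squared correlation, averaged over all ways to place the pair of sets in the cube. -/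
noncomputable def avgSq (m : (ι → ZMod 2) → β) (S T : Finset ι) : ℝ :=
  𝔼 τ : Equiv.Perm ι, corr m (S.map τ.toEmbedding) (T.map τ.toEmbedding) ^ 2

lemma avgSq_nonneg (m : (ι → ZMod 2) → β) (S T : Finset ι) : 0 ≤ avgSq m S T :=
  expect_nonneg fun _ _ => sq_nonneg _

lemma avgSq_comm (m : (ι → ZMod 2) → β) (S T : Finset ι) : avgSq m S T = avgSq m T S :=
  expect_congr rfl fun _ _ => by rw [corr_comm]

/-- Bound the single term by the Bessel sum over all T; what is left is corr(U,U) for a uniform set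
U of size #S. -/
lemma avgSq_le (m : (ι → ZMod 2) → β) (S T : Finset ι) :
    avgSq m S T ≤ (∑ U ∈ univ.powersetCard #S, corr m U U) / (Fintype.card ι).choose #S := by
  rw [← expect_perm_map S fun U => corr m U U]
  refine expect_le_expect fun τ _ => le_trans ?_ (sum_corr_sq_le m _)
  exact single_le_sum (f := fun T => corr m (S.map τ.toEmbedding) T ^ 2)
    (fun _ _ => sq_nonneg _) (mem_univ (T.map τ.toEmbedding))

/-- For fixed T the placed sets S are distinct, so extend their sum to all sets of size s. The
placed T is uniform among sets of size t, so Bessel applies for each U; finally count the choices of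
T in J. -/
lemma sum_sum_avgSq_le (m : (ι → ZMod 2) → β) (J : Finset ι) (s t : ℕ) :
    ∑ T ∈ J.powersetCard t, ∑ S ∈ J.powersetCard s, avgSq m S T ≤
      ((#J).choose t : ℝ) / (Fintype.card ι).choose t * ∑ U ∈ univ.powersetCard s, corr m U U := by
  set φ : Finset ι → ℝ := fun T => ∑ U ∈ univ.powersetCard s, corr m U T ^ 2 with hφ
  have h1 : ∀ T ∈ J.powersetCard t, ∑ S ∈ J.powersetCard s, avgSq m S T ≤
      (∑ T ∈ univ.powersetCard t, φ T) / (Fintype.card ι).choose t := by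
    intro T hT
    rw [← (mem_powersetCard.1 hT).2, ← expect_perm_map T φ]
    simp only [avgSq]
    rw [← expect_sum_comm]
    refine expect_le_expect fun τ _ => ?_
    refine le_trans (sum_map (J.powersetCard s) (mapEmbedding τ.toEmbedding).toEmbedding
      fun U => corr m U (T.map τ.toEmbedding) ^ 2).ge ?_
    refine sum_le_sum_of_subset_of_nonneg (fun U hU => ?_) fun _ _ _ => sq_nonneg _
    obtain ⟨S, hS, rfl⟩ := mem_map.1 hU
    simpa [mem_powersetCard] using (mem_powersetCard.1 hS).2
  have h2 : ∑ T ∈ univ.powersetCard t, φ T ≤ ∑ U ∈ univ.powersetCard s, corr m U U := by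
    rw [hφ, sum_comm]
    refine sum_le_sum fun U _ => le_trans ?_ (sum_corr_sq_le m U)
    exact sum_le_sum_of_subset_of_nonneg (subset_univ _) fun _ _ _ => sq_nonneg _
  refine (sum_le_sum h1).trans ?_
  rw [sum_const, card_powersetCard, nsmul_eq_mul, div_mul_eq_mul_div, mul_div_assoc]
  gcongr

end Corr

end BooleanCube

/-! ### Generalised Hölder and Finner's inequality -/

namespace MultiHypergraph

open Finset
open scoped BigOperators

/-- AM-GM in which an additional factor 1, at index `none`, carries the missing weight. -/
lemma prod_rpow_le_sum {κ : Type*} (s : Finset κ) (y : κ → ℝ) (hy : ∀ e ∈ s, 0 ≤ y e)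
    (hsum : ∑ e ∈ s, y e ≤ 1) (z : κ → ℝ) (hz : ∀ e ∈ s, 0 ≤ z e) :
    ∏ e ∈ s, z e ^ y e ≤ ∑ e ∈ s, y e * z e + (1 - ∑ e ∈ s, y e) := by
  have h := Real.geom_mean_le_arith_mean_weighted (insertNone s)
    (fun o => o.elim (1 - ∑ e ∈ s, y e) y) (fun o => o.elim 1 z)
    (by
      intro o ho
      cases o with
      | none => simpa using hsum
      | some e => exact hy e (by simpa using ho))
    (by simp [sum_insertNone])
    (by
      intro o ho
      cases o with
      | none => simp
      | some e => exact hz e (by simpa using ho))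
  simp only [prod_insertNone, sum_insertNone, Option.elim_none, Option.elim_some, Real.one_rpow,
    one_mul, mul_one] at h
  linarith

/-- Hölder's inequality for averages, with exponents of total at most `1`. -/
lemma expect_prod_rpow_le {κ X : Type*} [Fintype X] [Nonempty X] (s : Finset κ) (y : κ → ℝ)
    (hy : ∀ e ∈ s, 0 ≤ y e) (hsum : ∑ e ∈ s, y e ≤ 1) (f : κ → X → ℝ) (hf : ∀ e x, 0 ≤ f e x) :
    𝔼 x, ∏ e ∈ s, f e x ^ y e ≤ ∏ e ∈ s, (𝔼 x, f e x) ^ y e := by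
  have hE : ∀ e, 0 ≤ 𝔼 x, f e x := fun e => expect_nonneg fun x _ => hf e x
  by_cases hz : ∃ e ∈ s, y e ≠ 0 ∧ 𝔼 x, f e x = 0
  · obtain ⟨e, he, hye, h0⟩ := hz
    have hfe := (Finset.expect_eq_zero_iff_of_nonneg fun x _ => hf e x).1 h0
    have : ∀ x, ∏ e ∈ s, f e x ^ y e = 0 := fun x =>
      prod_eq_zero he (by rw [hfe x (mem_univ x), Real.zero_rpow hye])
    simp only [this, expect_const_zero]
    exact prod_nonneg fun e _ => Real.rpow_nonneg (hE e) _
  · push Not at hz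
    set a : κ → ℝ := fun e => 𝔼 x, f e x with ha
    have hpos : ∀ e ∈ s, 0 < a e ^ y e := by
      intro e he
      by_cases hye : y e = 0
      · simp [hye]
      · exact Real.rpow_pos_of_pos ((hE e).lt_of_ne' (hz e he hye)) _
    have hP : 0 < ∏ e ∈ s, a e ^ y e := prod_pos hpos
    have key : ∀ x, (∏ e ∈ s, f e x ^ y e) / ∏ e ∈ s, a e ^ y e ≤
        ∑ e ∈ s, y e * (f e x / a e) + (1 - ∑ e ∈ s, y e) := by
      intro x
      rw [← prod_div_distrib]
      refine (prod_congr rfl fun e _ => (Real.div_rpow (hf e x) (hE e) _).symm).le.trans ?_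
      exact prod_rpow_le_sum s y hy hsum _ fun e _ => div_nonneg (hf e x) (hE e)
    have h1 := expect_le_expect (s := univ) fun x _ => key x
    rw [← expect_div, expect_add_distrib, expect_sum_comm, Fintype.expect_const] at h1
    have h2 : ∑ e ∈ s, 𝔼 x, y e * (f e x / a e) ≤ ∑ e ∈ s, y e := by
      refine sum_le_sum fun e he => ?_
      rw [← mul_expect, ← expect_div]
      by_cases hye : y e = 0
      · simp [hye]
      · rw [div_self (hz e he hye), mul_one]
    exact (div_le_one hP).1 (by linarith)

variable {V E Ω : Type*} [Fintype V] [DecidableEq V] [Fintype E] [Fintype Ω] [Nonempty Ω]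

/-- Averaging over the coordinate `v`. -/
noncomputable def coordAvg (v : V) (f : (V → Ω) → ℝ) (π : V → Ω) : ℝ :=
  𝔼 x, f (Function.update π v x)

lemma expect_coordAvg (v : V) (f : (V → Ω) → ℝ) : 𝔼 π, coordAvg v f π = 𝔼 π, f π := by
  simp only [coordAvg]
  rw [expect_comm]
  have e1 : 𝔼 π, f π = 𝔼 p : Ω × ({j // j ≠ v} → Ω), f ((Equiv.funSplitAt v Ω).symm p) :=
    Fintype.expect_equiv (Equiv.funSplitAt v Ω) _ _ fun π =>
      congrArg f ((Equiv.funSplitAt v Ω).symm_apply_apply π).symm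
  have e2 : ∀ x, 𝔼 π, f (Function.update π v x) =
      𝔼 p : Ω × ({j // j ≠ v} → Ω), f ((Equiv.funSplitAt v Ω).symm (x, p.2)) := by
    intro x
    refine Fintype.expect_equiv (Equiv.funSplitAt v Ω) _ _ fun π => ?_
    congr 1
  simp only [e1, e2]
  rw [← univ_product_univ, expect_product]
  refine expect_congr rfl fun x _ => ?_
  rw [expect_product]
  exact Fintype.expect_const (ι := Ω) (𝔼 ρ, f ((Equiv.funSplitAt v Ω).symm (x, ρ)))

/-- Finner's inequality for a product of copies of a uniform space. -/
theorem finner (H : MultiHypergraph V E) (y : E → ℝ) (hy : ∀ e, 0 ≤ y e)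
    (hsum : ∀ v, ∑ e with v ∈ H.ends e, y e ≤ 1) (f : E → (V → Ω) → ℝ) (hf : ∀ e π, 0 ≤ f e π)
    (hdep : ∀ e v, v ∉ H.ends e → ∀ π x, f e (Function.update π v x) = f e π) :
    𝔼 π, ∏ e, f e π ^ y e ≤ ∏ e, (𝔼 π, f e π) ^ y e := by
  -- Induction on the set s of coordinates that the functions may still depend on; each step
  -- averages one coordinate out.
  suffices h : ∀ (s : Finset V) (f : E → (V → Ω) → ℝ), (∀ e π, 0 ≤ f e π) →
      (∀ e v, v ∉ H.ends e → ∀ π x, f e (Function.update π v x) = f e π) →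
      (∀ e v, v ∉ s → ∀ π x, f e (Function.update π v x) = f e π) →
      𝔼 π, ∏ e, f e π ^ y e ≤ ∏ e, (𝔼 π, f e π) ^ y e from
    h univ f hf hdep fun e v hv => absurd (mem_univ v) hv
  intro s
  induction s using Finset.induction_on with
  | empty =>
    intro f hf hdep hs
    have hconst : ∀ e (π ρ : V → Ω), f e π = f e ρ := by
      intro e π ρ
      have : ∀ t : Finset V, f e (t.piecewise π ρ) = f e ρ := by
        intro t
        induction t using Finset.induction_on with
        | empty => simp
        | insert v t hv ih => rw [piecewise_insert, hs e v (notMem_empty v), ih]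
      simpa using this univ
    obtain ⟨π₀⟩ : Nonempty (V → Ω) := inferInstance
    have h1 : ∀ e, 𝔼 π, f e π = f e π₀ := fun e => by
      rw [expect_congr rfl fun π _ => hconst e π π₀, Fintype.expect_const]
    simp only [h1]
    rw [expect_congr rfl fun π _ => prod_congr rfl fun e _ => by rw [hconst e π π₀],
      Fintype.expect_const]
  | insert v s hv ih =>
    intro f hf hdep hs
    -- Hölder in coordinate v alone: only the edges through v vary, and their exponents sum to at
    -- most 1.
    have hstep : 𝔼 π, ∏ e, f e π ^ y e ≤ 𝔼 π, ∏ e, coordAvg v (f e) π ^ y e := by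
      rw [← expect_coordAvg v]
      refine expect_le_expect fun π _ => ?_
      have hout : ∀ e ∈ univ.filter (fun e => ¬ v ∈ H.ends e), ∀ x,
          f e (Function.update π v x) = f e π := fun e he x =>
        hdep e v (mem_filter.1 he).2 π x
      have hout' : ∏ e with ¬ v ∈ H.ends e, coordAvg v (f e) π ^ y e =
          ∏ e with ¬ v ∈ H.ends e, f e π ^ y e := by
        refine prod_congr rfl fun e he => ?_
        rw [coordAvg, expect_congr rfl fun x _ => hout e he x, Fintype.expect_const]
      rw [coordAvg, ← prod_filter_mul_prod_filter_not univ (fun e => v ∈ H.ends e), hout']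
      have h2 : ∀ x, ∏ e, f e (Function.update π v x) ^ y e =
          (∏ e with v ∈ H.ends e, f e (Function.update π v x) ^ y e) *
            ∏ e with ¬ v ∈ H.ends e, f e π ^ y e := by
        intro x
        rw [← prod_filter_mul_prod_filter_not univ (fun e => v ∈ H.ends e)]
        congr 1
        exact prod_congr rfl fun e he => by rw [hout e he x]
      simp only [h2]
      rw [← expect_mul]
      refine mul_le_mul_of_nonneg_right ?_ (prod_nonneg fun e _ => Real.rpow_nonneg (hf e π) _)
      exact expect_prod_rpow_le _ y (fun e _ => hy e) (hsum v)
        (fun e x => f e (Function.update π v x)) fun e x => hf e _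
    refine hstep.trans ((ih (fun e => coordAvg v (f e)) ?_ ?_ ?_).trans (le_of_eq ?_))
    · exact fun e π => expect_nonneg fun x _ => hf e _
    · intro e w hw π x
      refine expect_congr rfl fun z _ => ?_
      by_cases hwv : w = v
      · subst hwv; rw [Function.update_idem]
      · rw [Function.update_comm hwv, hdep e w hw]
    · intro e w hw π x
      refine expect_congr rfl fun z _ => ?_
      by_cases hwv : w = v
      · subst hwv; rw [Function.update_idem]
      · rw [Function.update_comm hwv, hs e w (by simp [hwv, hw])]
    · simp only [expect_coordAvg]


end MultiHypergraph

/-! ### Linear programming duality for the modified cover number -/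

namespace MultiHypergraph

open Finset

variable {V E : Type*} [Fintype V] [Fintype E]

/-- Average the covering constraints of two distinct edges. This makes M ≥ 1 available later. -/
lemma one_le_mvc (H : MultiHypergraph V E) (hE : 1 < Fintype.card E) :
    1 ≤ H.mvc 2⁻¹ (fun _ => 1) := by
  classical
  obtain ⟨a, b, hab⟩ := Fintype.one_lt_card_iff.1 hE
  refine le_iInf₂ fun f hf => ?_
  have hS : ∀ e, ∑ v ∈ H.ends e, f (Sum.inl v) ≤ ∑ v, f (Sum.inl v) := fun e =>
    sum_le_sum_of_subset (subset_univ _)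
  have hab' : f (Sum.inr a) + f (Sum.inr b) ≤ ∑ e, f (Sum.inr e) := by
    rw [← sum_pair (f := fun e => f (Sum.inr e)) hab]
    exact sum_le_sum_of_subset (subset_univ _)
  calc (1 : ENNReal) = 2⁻¹ * 1 + 2⁻¹ * 1 := by rw [mul_one, ENNReal.inv_two_add_inv_two]
    _ ≤ 2⁻¹ * (∑ v, f (Sum.inl v) + f (Sum.inr a)) +
        2⁻¹ * (∑ v, f (Sum.inl v) + f (Sum.inr b)) := by
        gcongr
        · exact (hf a).trans (by exact add_le_add_left (hS a) _)
        · exact (hf b).trans (by exact add_le_add_left (hS b) _)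
    _ = (2⁻¹ + 2⁻¹) * ∑ v, f (Sum.inl v) + 2⁻¹ * (f (Sum.inr a) + f (Sum.inr b)) := by ring
    _ ≤ _ := by
        rw [ENNReal.inv_two_add_inv_two, one_mul]
        gcongr

/-- For given vertex weights the cheapest edge weights are the positive parts of the deficits. -/
lemma mvc_le_of_weights (H : MultiHypergraph V E) (β : V → ℝ) (hβ : ∀ v, 0 ≤ β v) :
    H.mvc 2⁻¹ (fun _ => 1) ≤
      ENNReal.ofReal (∑ v, β v + 1 / 2 * ∑ e, max 0 (1 - ∑ v ∈ H.ends e, β v)) := by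
  refine (iInf₂_le (fun x => Sum.elim (fun v => ENNReal.ofReal (β v))
    (fun e => ENNReal.ofReal (max 0 (1 - ∑ v ∈ H.ends e, β v))) x) fun e => ?_).trans ?_
  · simp only [Sum.elim_inl, Sum.elim_inr]
    rw [← ENNReal.ofReal_sum_of_nonneg fun v _ => hβ v, ← ENNReal.ofReal_add
      (sum_nonneg fun v _ => hβ v) (le_max_left _ _), ← ENNReal.ofReal_one]
    refine ENNReal.ofReal_le_ofReal ?_
    linarith [le_max_right 0 (1 - ∑ v ∈ H.ends e, β v)]
  · simp only [Sum.elim_inl, Sum.elim_inr]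
    have h0 : ∀ e ∈ univ, 0 ≤ max 0 (1 - ∑ v ∈ H.ends e, β v) := fun e _ => le_max_left _ _
    rw [ENNReal.ofReal_add (sum_nonneg fun v _ => hβ v)
      (mul_nonneg (by norm_num) (sum_nonneg h0)), ENNReal.ofReal_mul (by norm_num),
      ENNReal.ofReal_sum_of_nonneg fun v _ => hβ v, ENNReal.ofReal_sum_of_nonneg h0]
    gcongr
    rw [one_div, ENNReal.ofReal_inv_of_pos (by norm_num)]
    simp

open Classical in
/-- If no fractional matching with weights at most `1/2` has total weight `r` or more, then
some fractional cover has cost less than `r`. -/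
lemma exists_weights_lt (H : MultiHypergraph V E) {r : ℝ}
    (hlt : ∀ y : E → ℝ, (∀ e, 0 ≤ y e ∧ y e ≤ 1 / 2) →
      (∀ v, ∑ e with v ∈ H.ends e, y e ≤ 1) → ∑ e, y e < r) :
    ∃ β : V → ℝ, (∀ v, 0 ≤ β v) ∧
      ∑ v, β v + 1 / 2 * ∑ e, max 0 (1 - ∑ v ∈ H.ends e, β v) < r := by
  -- A records the total weight and the vertex loads. Infeasibility means that the image of the box
  -- misses {total ≥ r, loads ≤ 1}; a separating functional yields the dual prices α and β.
  let A : (E → ℝ) →ₗ[ℝ] ℝ × (V → ℝ) :=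
    { toFun := fun y => (∑ e, y e, fun v => ∑ e with v ∈ H.ends e, y e)
      map_add' := fun y z => by ext <;> simp [sum_add_distrib]
      map_smul' := fun c y => by ext <;> simp [mul_sum] }
  have hA : Continuous A := A.continuous_of_finiteDimensional
  let C : Set (ℝ × (V → ℝ)) := A '' Set.Icc 0 (fun _ => 1 / 2)
  let D : Set (ℝ × (V → ℝ)) := Set.Ici r ×ˢ Set.Iic (fun _ => 1)
  have hdisj : Disjoint C D := by
    rw [Set.disjoint_left]
    rintro _ ⟨y, hy, rfl⟩ ⟨h1, h2⟩
    exact absurd (hlt y (fun e => ⟨hy.1 e, hy.2 e⟩) fun v => h2 v) (not_lt.2 h1)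
  obtain ⟨f, u, w, hfC, huw, hfD⟩ := geometric_hahn_banach_compact_closed
    ((convex_Icc _ _).linear_image A) (isCompact_Icc.image hA)
    ((convex_Ici r).prod (convex_Iic (fun _ : V => (1 : ℝ))))
    (isClosed_Ici.prod isClosed_Iic) hdisj
  set α : ℝ := f (1, 0) with hα
  set β : V → ℝ := fun v => - f (0, Pi.single v 1) with hβ
  have hf : ∀ a b, f (a, b) = α * a - ∑ v, β v * b v := by
    intro a b
    have h1 : (a, b) = a • ((1 : ℝ), (0 : V → ℝ)) + ∑ v, b v • ((0 : ℝ), (Pi.single v 1 : V → ℝ)) := by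
      ext i
      · simp [Prod.fst_sum]
      · simp [Prod.snd_sum, Finset.sum_apply, Pi.single_apply]
    rw [h1, map_add, map_smul, map_sum]
    simp only [map_smul, smul_eq_mul, hβ, neg_mul, sum_neg_distrib, sub_neg_eq_add]
    rw [mul_comm]
    congr 1
    exact sum_congr rfl fun v _ => mul_comm _ _
  have hβ1 : ∀ v : V, ∀ t : ℝ, ∑ w, β w * (1 - t * (Pi.single v 1 : V → ℝ) w) =
      ∑ w, β w - t * β v := by
    intro v t
    simp only [mul_sub, mul_one, sum_sub_distrib, Pi.single_apply]
    simp [mul_comm]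
  have hα0 : 0 ≤ α := by
    by_contra! hneg
    -- If α were negative, a large enough total would push the functional below w; the same device
    -- with very negative loads gives β ≥ 0.
    have h := hfD (max r ((w + ∑ v, β v) / α), fun _ => 1) ⟨Set.mem_Ici.2 (le_max_left _ _), Set.self_mem_Iic⟩
    rw [hf] at h
    have h2 := mul_le_mul_of_nonpos_left (le_max_right r ((w + ∑ v, β v) / α)) hneg.le
    rw [mul_div_cancel₀ _ hneg.ne] at h2
    simp only [mul_one] at h
    linarith
  have hβ0 : ∀ v, 0 ≤ β v := by
    intro v
    by_contra! hneg
    set t := max 0 ((w - α * r + ∑ v, β v) / β v) with ht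
    have h := hfD (r, fun w => 1 - t * (Pi.single v 1 : V → ℝ) w) ⟨Set.self_mem_Ici, fun w => by
      have : 0 ≤ t * (Pi.single v 1 : V → ℝ) w := by
        refine mul_nonneg (le_max_left _ _) ?_
        rw [Pi.single_apply]; split_ifs <;> norm_num
      simpa using this⟩
    rw [hf, hβ1] at h
    have h2 := mul_le_mul_of_nonpos_left (le_max_right 0 ((w - α * r + ∑ v, β v) / β v)) hneg.le
    rw [mul_div_cancel₀ _ hneg.ne, ← ht] at h2
    linarith
  have hr1 : w < α * r - ∑ v, β v := by
    have := hfD (r, fun _ => 1) ⟨Set.self_mem_Ici, Set.self_mem_Iic⟩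
    simpa [hf] using this
  have hu0 : 0 < u := by
    have := hfC (A 0) ⟨0, ⟨le_rfl, fun _ => by norm_num⟩, rfl⟩
    simpa using this
  have hβs : 0 ≤ ∑ v, β v := sum_nonneg fun v _ => hβ0 v
  have hαpos : 0 < α := by
    rcases hα0.eq_or_lt with h | h
    · rw [← h] at hr1; linarith
    · exact h
  refine ⟨fun v => β v / α, fun v => div_nonneg (hβ0 v) hα0, ?_⟩
  -- The vertex of the box maximising the separating functional, whose value there is the edge cost
  -- scaled by α.
  set y : E → ℝ := fun e => if ∑ v ∈ H.ends e, β v < α then 1 / 2 else 0 with hy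
  have hyC := hfC (A y) ⟨y, ⟨fun e => by simp only [hy]; split_ifs <;> simp,
    fun e => by simp only [hy]; split_ifs <;> simp⟩, rfl⟩
  have hAy : f (A y) = ∑ e, 1 / 2 * max 0 (α - ∑ v ∈ H.ends e, β v) := by
    have : f (A y) = α * ∑ e, y e - ∑ v, β v * ∑ e with v ∈ H.ends e, y e := hf _ _
    rw [this, mul_sum]
    simp only [mul_sum, sum_filter]
    rw [sum_comm, ← sum_sub_distrib]
    refine sum_congr rfl fun e _ => ?_
    have e1 : ∑ v, β v * (if v ∈ H.ends e then y e else 0) = (∑ v ∈ H.ends e, β v) * y e := by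
      rw [sum_mul]; simp [sum_ite_mem]
    rw [e1, ← sub_mul]
    simp only [hy]
    split_ifs with h
    · rw [max_eq_right (by linarith)]; ring
    · rw [max_eq_left (by linarith)]; ring
  have hmax : ∀ e, max 0 (1 - ∑ v ∈ H.ends e, β v / α) =
      max 0 (α - ∑ v ∈ H.ends e, β v) / α := by
    intro e
    rw [← max_div_div_right hα0, zero_div, sub_div, div_self hαpos.ne', sum_div]
  simp only [hmax]
  rw [← sum_div, ← sum_div, ← mul_div_assoc, ← add_div, div_lt_iff₀ hαpos, mul_sum, ← hAy]
  linarith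

open Classical in
/-- Linear programming duality for `mvc`: a fractional matching with edge weights at most `1/2`
whose total weight is at least the modified fractional vertex cover number. -/
theorem exists_fractional_matching (H : MultiHypergraph V E) :
    ∃ y : E → ℝ, (∀ e, 0 ≤ y e ∧ y e ≤ 1 / 2) ∧ (∀ v, ∑ e with v ∈ H.ends e, y e ≤ 1) ∧
      H.mvc 2⁻¹ (fun _ => 1) ≤ ENNReal.ofReal (∑ e, y e) := by
  set Q : Set (E → ℝ) := Set.Icc 0 (fun _ => 1 / 2) ∩ ⋂ v, {y | ∑ e with v ∈ H.ends e, y e ≤ 1}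
  have hQc : IsCompact Q := isCompact_Icc.inter_right <| isClosed_iInter fun v =>
    isClosed_le (by fun_prop) continuous_const
  have hQ0 : (0 : E → ℝ) ∈ Q := ⟨⟨le_rfl, fun _ => by norm_num⟩, by simp⟩
  obtain ⟨y, hyQ, hy⟩ := hQc.exists_isMaxOn ⟨0, hQ0⟩
    (f := fun y : E → ℝ => ∑ e, y e) (by fun_prop)
  have hy0 : 0 ≤ ∑ e, y e := sum_nonneg fun e _ => hyQ.1.1 e
  refine ⟨y, fun e => ⟨hyQ.1.1 e, hyQ.1.2 e⟩, fun v => Set.mem_iInter.1 hyQ.2 v, ?_⟩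
  by_contra! hlt
  -- No matching attains a value r strictly above the maximum, so some cover costs less than r,
  -- contradicting r < `mvc`.
  obtain ⟨r, -, hr1, hr2⟩ := ENNReal.lt_iff_exists_real_btwn.1 hlt
  obtain ⟨β, hβ, hβr⟩ := H.exists_weights_lt fun z hz hz' =>
    (hy ⟨⟨fun e => (hz e).1, fun e => (hz e).2⟩, Set.mem_iInter.2 hz'⟩).trans_lt
      ((ENNReal.ofReal_lt_ofReal_iff_of_nonneg hy0).1 hr1)
  exact absurd ((H.mvc_le_of_weights β hβ).trans (ENNReal.ofReal_le_ofReal hβr.le)) (not_le.2 hr2)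

end MultiHypergraph

/-! ### Binomial estimates and summation over set sizes -/

namespace BooleanCube

open Finset
open scoped BigOperators

/-- Each increase of t multiplies the ratio by (K - t)/(n - t) ≤ K/n. -/
lemma choose_div_choose_le {n K : ℕ} (hKn : K ≤ n) {s t : ℕ} (hst : s ≤ t) (htn : t ≤ n) :
    (K.choose t / n.choose t : ℝ) ≤ (K / n : ℝ) ^ (t - s) * (K.choose s / n.choose s) := by
  induction t, hst using Nat.le_induction with
  | base => simp
  | succ t hst ih =>
    have ih := ih (by omega)
    rw [Nat.succ_sub hst, pow_succ', mul_assoc]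
    refine le_trans ?_ (mul_le_mul_of_nonneg_left ih (by positivity))
    rcases Nat.lt_or_ge K (t + 1) with h | h
    · rw [Nat.choose_eq_zero_of_lt h]; simp; positivity
    have e : ∀ N : ℕ, t + 1 ≤ N → (N.choose (t + 1) : ℝ) = N.choose t * (N - t) / (t + 1) := by
      intro N hN
      rw [eq_div_iff (by positivity)]
      have := Nat.choose_succ_right_eq N t
      have h : ((N - t : ℕ) : ℝ) = N - t := by rw [Nat.cast_sub (by omega)]
      rw [← h]; exact_mod_cast this
    rw [e K h, e n htn]
    have h1 : (0 : ℝ) < n.choose t := by exact_mod_cast Nat.choose_pos (by omega)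
    have h2 : (0 : ℝ) < n - t := by
      rw [sub_pos]; exact_mod_cast htn
    have h3 : (0 : ℝ) < n := by
      have : 0 < n := by omega
      exact_mod_cast this
    have h4 : (K : ℝ) ≤ n := by exact_mod_cast hKn
    have h5 : (K - t : ℝ) / (n - t) ≤ K / n := by
      rw [div_le_div_iff₀ h2 h3]
      nlinarith [(Nat.cast_nonneg t : (0 : ℝ) ≤ t)]
    calc (K.choose t * (K - t) / (t + 1) / (n.choose t * (n - t) / (t + 1)) : ℝ)
        = (K - t : ℝ) / (n - t) * (K.choose t / n.choose t) := by field_simp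
      _ ≤ _ := mul_le_mul_of_nonneg_right h5 (by positivity)

lemma pow_le_pow_mul_choose {n s : ℕ} (hsn : s ≤ n) : n ^ s ≤ s ^ s * n.choose s := by
  induction s generalizing n with
  | zero => simp
  | succ s ih =>
    obtain ⟨n, rfl⟩ : ∃ k, n = k + 1 := ⟨n - 1, by omega⟩
    have hsn' : s ≤ n := by omega
    rcases Nat.eq_zero_or_pos s with rfl | hs
    · simp
    have h1 : s * (n + 1) ≤ (s + 1) * n := by nlinarith
    have h2 : s ^ s * (n + 1) ^ s ≤ s ^ s * ((s + 1) ^ s * n.choose s) := by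
      calc s ^ s * (n + 1) ^ s = (s * (n + 1)) ^ s := (mul_pow _ _ _).symm
        _ ≤ ((s + 1) * n) ^ s := Nat.pow_le_pow_left h1 s
        _ = (s + 1) ^ s * n ^ s := mul_pow _ _ _
        _ ≤ (s + 1) ^ s * (s ^ s * n.choose s) := Nat.mul_le_mul_left _ (ih hsn')
        _ = _ := by ring
    have h3 := Nat.le_of_mul_le_mul_left h2 (by positivity)
    calc (n + 1) ^ (s + 1) = (n + 1) * (n + 1) ^ s := pow_succ' _ _
      _ ≤ (n + 1) * ((s + 1) ^ s * n.choose s) := Nat.mul_le_mul_left _ h3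
      _ = (s + 1) ^ s * ((n + 1) * n.choose s) := by ring
      _ = (s + 1) ^ s * ((n + 1).choose (s + 1) * (s + 1)) := by
          rw [Nat.add_one_mul_choose_eq]
      _ = _ := by ring

/-- The bound on the average level-`s` weight of the fibres of a `c`-bit message. -/
noncomputable def levelWeight (c s : ℕ) : ℝ := (2 + 4 * c / s) ^ s

lemma levelWeight_nonneg (c s : ℕ) : 0 ≤ levelWeight c s := by
  unfold levelWeight; positivity

lemma levelWeight_div_choose_le {n c s : ℕ} (hs : 1 ≤ s) (hsn : s ≤ n) :
    levelWeight c s / n.choose s ≤ ((2 * s + 4 * c) / n) ^ s := by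
  have hs0 : (0 : ℝ) < s := by exact_mod_cast hs
  have hn0 : (0 : ℝ) < n := by
    have : 0 < n := by omega
    exact_mod_cast this
  have hC : (0 : ℝ) < n.choose s := by exact_mod_cast Nat.choose_pos hsn
  have h : (n : ℝ) ^ s ≤ s ^ s * n.choose s := by exact_mod_cast pow_le_pow_mul_choose hsn
  have e : (2 * s + 4 * c : ℝ) = s * (2 + 4 * c / s) := by field_simp
  rw [levelWeight, e, div_pow, mul_pow, div_le_div_iff₀ hC (by positivity)]
  calc (2 + 4 * c / s : ℝ) ^ s * n ^ s ≤ (2 + 4 * c / s : ℝ) ^ s * (s ^ s * n.choose s) := by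
        gcongr
    _ = _ := by ring

section

variable {n K c : ℕ} {M : ℝ}

/-- Writing θ = K(12c/n)^M, the contribution of pairs of equal size s decays like θ 2^(1-s). -/
lemma diagonal_term_le {s : ℕ} (hs : 1 ≤ s) (hsK : s ≤ K) (hKn : 10 * K ≤ n) (hc : 1 ≤ c)
    (hM : 1 ≤ M) (hθ : K * (12 * c / n : ℝ) ^ M ≤ 1 / 2) :
    (levelWeight c s / n.choose s) ^ (M - 1) * (K.choose s / n.choose s * levelWeight c s) ≤
      K * (12 * c / n : ℝ) ^ M * (1 / 2) ^ (s - 1) := by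
  have hsn : s ≤ n := by omega
  have hs0 : (0 : ℝ) < s := by exact_mod_cast hs
  have hc0 : (1 : ℝ) ≤ c := by exact_mod_cast hc
  have hn0 : (0 : ℝ) < n := by
    have : 0 < n := by omega
    exact_mod_cast this
  have hK0 : (0 : ℝ) ≤ K := by positivity
  have hKn' : 10 * (K : ℝ) ≤ n := by exact_mod_cast hKn
  have hsK' : (s : ℝ) ≤ K := by exact_mod_cast hsK
  have hC : (0 : ℝ) < n.choose s := by exact_mod_cast Nat.choose_pos hsn
  have hW := levelWeight_nonneg c s
  have hWC : 0 ≤ levelWeight c s / n.choose s := by positivity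
  have hM1 : 0 ≤ M - 1 := by linarith
  have hB := levelWeight_div_choose_le (c := c) hs hsn
  have hθ0 : 0 ≤ K * (12 * c / n : ℝ) ^ M := by positivity
  -- For s ≤ 4c the term is at most θ^s. For larger s the level weight is at most 3^s, and the decay
  -- comes from 3K/n ≤ 3/10; one factor 12c/n is kept to rebuild θ.
  by_cases hsc : s ≤ 4 * c
  · have hsc' : (s : ℝ) ≤ 4 * c := by exact_mod_cast hsc
    have h1 : levelWeight c s / n.choose s ≤ (12 * c / n) ^ s := by
      refine hB.trans (pow_le_pow_left₀ (by positivity) ?_ s)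
      gcongr
      linarith
    have h2 : (K.choose s : ℝ) ≤ K ^ s := by exact_mod_cast Nat.choose_le_pow K s
    calc (levelWeight c s / n.choose s) ^ (M - 1) * (K.choose s / n.choose s * levelWeight c s)
        = K.choose s * ((levelWeight c s / n.choose s) ^ (M - 1) *
            (levelWeight c s / n.choose s)) := by ring
      _ = K.choose s * (levelWeight c s / n.choose s) ^ M := by
          congr 1
          rw [← Real.rpow_add_one' hWC (by linarith)]
          congr 1; ring
      _ ≤ K ^ s * ((12 * c / n) ^ s) ^ M := by gcongr
      _ = (K * (12 * c / n : ℝ) ^ M) ^ s := by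
          rw [mul_pow, ← Real.rpow_natCast (12 * c / n : ℝ) s, ← Real.rpow_mul (by positivity),
            mul_comm (s : ℝ), Real.rpow_mul (by positivity), Real.rpow_natCast]
      _ = K * (12 * c / n : ℝ) ^ M * (K * (12 * c / n : ℝ) ^ M) ^ (s - 1) := by
          rw [← pow_succ', Nat.sub_add_cancel hs]
      _ ≤ _ := by gcongr
  · have hsc' : 4 * (c : ℝ) ≤ s := by
      have : 4 * c ≤ s := by omega
      exact_mod_cast this
    have h1 : levelWeight c s ≤ 3 ^ s := by
      refine pow_le_pow_left₀ (by positivity) ?_ s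
      have : 4 * (c : ℝ) / s ≤ 1 := (div_le_one hs0).2 hsc'
      linarith
    have h2 : (K.choose s / n.choose s : ℝ) ≤ (K / n) ^ s := by
      simpa using choose_div_choose_le (K := K) (by omega) (Nat.zero_le s) hsn
    have h3 : levelWeight c s / n.choose s ≤ 12 * c / n := by
      have h4 : (s : ℝ) * (3 / 10) ^ (s - 1) ≤ 1 := by
        -- Bernoulli gives s ≤ (10/3)^(s-1), matching the base 3s/n ≤ 3/10 available since s ≤ K ≤
        -- n/10.
        have h5 := one_add_mul_le_pow (a := (7 / 3 : ℝ)) (by norm_num) (s - 1)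
        rw [Nat.cast_sub hs, Nat.cast_one] at h5
        have h6 : (s : ℝ) ≤ (10 / 3) ^ (s - 1) := by
          have : (1 + 7 / 3 : ℝ) = 10 / 3 := by norm_num
          rw [this] at h5
          have : (1 : ℝ) ≤ s := by exact_mod_cast hs
          linarith
        calc (s : ℝ) * (3 / 10) ^ (s - 1) ≤ (10 / 3) ^ (s - 1) * (3 / 10) ^ (s - 1) := by gcongr
          _ = 1 := by rw [← mul_pow]; norm_num
      calc levelWeight c s / n.choose s ≤ ((2 * s + 4 * c) / n) ^ s := hB
        _ ≤ (3 * s / n) ^ s := by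
            refine pow_le_pow_left₀ (by positivity) ?_ s
            gcongr
            linarith
        _ = 3 * s / n * (3 * s / n) ^ (s - 1) := by rw [← pow_succ', Nat.sub_add_cancel hs]
        _ ≤ 3 * s / n * (3 / 10) ^ (s - 1) := by
            gcongr ?_ * ?_ ^ _
            rw [div_le_div_iff₀ hn0 (by norm_num)]
            linarith
        _ = 3 * (s * (3 / 10) ^ (s - 1)) / n := by ring
        _ ≤ 12 * c / n := by
            gcongr ?_ / _
            linarith
    have h4 : (K / n : ℝ) ^ s * 3 ^ s ≤ K * (12 * c / n) * (1 / 2) ^ (s - 1) := by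
      calc (K / n : ℝ) ^ s * 3 ^ s = (3 * K / n) ^ s := by rw [← mul_pow]; ring
        _ = 3 * K / n * (3 * K / n) ^ (s - 1) := by rw [← pow_succ', Nat.sub_add_cancel hs]
        _ ≤ K * (12 * c / n) * (1 / 2) ^ (s - 1) := by
            gcongr ?_ * ?_ ^ _
            · rw [← mul_div_assoc]
              gcongr ?_ / _
              nlinarith
            · rw [div_le_div_iff₀ hn0 (by norm_num)]
              linarith
    calc (levelWeight c s / n.choose s) ^ (M - 1) * (K.choose s / n.choose s * levelWeight c s)
        ≤ (12 * c / n) ^ (M - 1) * ((K / n : ℝ) ^ s * 3 ^ s) := by gcongr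
      _ ≤ (12 * c / n) ^ (M - 1) * (K * (12 * c / n) * (1 / 2) ^ (s - 1)) := by gcongr
      _ = K * ((12 * c / n : ℝ) ^ (M - 1) * (12 * c / n)) * (1 / 2) ^ (s - 1) := by ring
      _ = _ := by
          rw [← Real.rpow_add_one' (by positivity) (by linarith), sub_add_cancel]

lemma offDiagonal_term_le {s t : ℕ} (hs : 1 ≤ s) (hst : s ≤ t) (htK : t ≤ K) (hKn : 10 * K ≤ n)
    (hc : 1 ≤ c) (hM : 1 ≤ M) (hθ : K * (12 * c / n : ℝ) ^ M ≤ 1 / 2) :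
    (levelWeight c s / n.choose s) ^ (M - 1) * (K.choose t / n.choose t * levelWeight c s) ≤
      K * (12 * c / n : ℝ) ^ M * (1 / 2) ^ (t - 1) := by
  have hn0 : (0 : ℝ) < n := by
    have : 0 < n := by omega
    exact_mod_cast this
  have hKn' : 10 * (K : ℝ) ≤ n := by exact_mod_cast hKn
  have hW := levelWeight_nonneg c s
  have h1 : (K.choose t / n.choose t : ℝ) ≤ (1 / 2) ^ (t - s) * (K.choose s / n.choose s) := by
    refine (choose_div_choose_le (by omega) hst (by omega)).trans ?_
    gcongr ?_ ^ _ * _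
    rw [div_le_div_iff₀ hn0 (by norm_num)]
    linarith [(Nat.cast_nonneg K : (0 : ℝ) ≤ K)]
  calc (levelWeight c s / n.choose s) ^ (M - 1) * (K.choose t / n.choose t * levelWeight c s)
      ≤ (levelWeight c s / n.choose s) ^ (M - 1) *
        ((1 / 2) ^ (t - s) * (K.choose s / n.choose s) * levelWeight c s) := by gcongr
    _ = (1 / 2) ^ (t - s) * ((levelWeight c s / n.choose s) ^ (M - 1) *
        (K.choose s / n.choose s * levelWeight c s)) := by ring
    _ ≤ (1 / 2) ^ (t - s) * (K * (12 * c / n : ℝ) ^ M * (1 / 2) ^ (s - 1)) :=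
        mul_le_mul_of_nonneg_left (diagonal_term_le hs (hst.trans htK) hKn hc hM hθ)
          (by positivity)
    _ = K * (12 * c / n : ℝ) ^ M * ((1 / 2) ^ (t - s) * (1 / 2) ^ (s - 1)) := by ring
    _ = _ := by rw [← pow_add]; congr 2; omega

/-- The exact value makes the induction close; only the bound 6 matters later. -/
lemma sum_sum_half_pow_max (K : ℕ) :
    ∑ i ∈ range K, ∑ j ∈ range K, (1 / 2 : ℝ) ^ max i j = 6 - (4 * K + 6) * (1 / 2) ^ K := by
  induction K with
  | zero => simp
  | succ K ih =>
    have h1 : ∀ i ∈ range K, (1 / 2 : ℝ) ^ max i K = (1 / 2) ^ K := fun i hi => by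
      rw [max_eq_right (mem_range.1 hi).le]
    have h2 : ∀ j ∈ range (K + 1), (1 / 2 : ℝ) ^ max K j = (1 / 2) ^ K := fun j hj => by
      rw [max_eq_left (by have := mem_range.1 hj; omega)]
    rw [sum_range_succ, sum_congr rfl h2]
    simp only [sum_range_succ _ K, sum_add_distrib]
    rw [ih, sum_congr rfl h1]
    simp only [sum_const, card_range, nsmul_eq_mul]
    push_cast
    ring

variable {ι : Type*}

lemma sum_le_sum_powersetCard (J : Finset ι) (A : Finset (Finset ι))
    (hA : ∀ S ∈ A, S ⊆ J ∧ S.Nonempty) (f : Finset ι → ℝ) (hf : ∀ S, 0 ≤ f S) :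
    ∑ S ∈ A, f S ≤ ∑ i ∈ range #J, ∑ S ∈ J.powersetCard (i + 1), f S := by
  have hmaps : ∀ S ∈ A, #S - 1 ∈ range #J := fun S hS => by
    have h1 := card_le_card (hA S hS).1
    have h2 := (hA S hS).2.card_pos
    rw [mem_range]; omega
  rw [← sum_fiberwise_of_maps_to hmaps]
  refine sum_le_sum fun i _ => sum_le_sum_of_subset_of_nonneg (fun S hS => ?_) fun _ _ _ => hf _
  obtain ⟨hSA, hSi⟩ := mem_filter.1 hS
  have h2 := (hA S hSA).2.card_pos
  exact mem_powersetCard.2 ⟨(hA S hSA).1, by omega⟩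

/-- Split Q^M = Q^(M-1) Q. Bound the first factor pointwise through the smaller of the two sizes and
sum the second over all pairs of these sizes. Symmetry of Q lets the smaller set come first, leaving
a geometric series in the larger size. -/
lemma sum_sum_rpow_le (J : Finset ι) (hJ : #J = K)
    (A : Finset (Finset ι)) (hA : ∀ S ∈ A, S ⊆ J ∧ S.Nonempty)
    (Q : Finset ι → Finset ι → ℝ) (hQ0 : ∀ S T, 0 ≤ Q S T) (hQsymm : ∀ S T, Q S T = Q T S)
    (hQ1 : ∀ S T, S.Nonempty → Q S T ≤ levelWeight c #S / n.choose #S)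
    (hQ2 : ∀ s t, 1 ≤ s → ∑ T ∈ J.powersetCard t, ∑ S ∈ J.powersetCard s, Q S T ≤
      K.choose t / n.choose t * levelWeight c s)
    (hKn : 10 * K ≤ n) (hc : 1 ≤ c) (hM : 1 ≤ M) (hθ : K * (12 * c / n : ℝ) ^ M ≤ 1 / 2) :
    ∑ S ∈ A, ∑ T ∈ A, Q S T ^ M ≤ 8 * (K * (12 * c / n : ℝ) ^ M) := by
  have hθ0 : 0 ≤ K * (12 * c / n : ℝ) ^ M := by positivity
  have hP0 : ∀ S T, 0 ≤ Q S T ^ M := fun S T => Real.rpow_nonneg (hQ0 S T) M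
  set Z : ℕ → ℕ → ℝ := fun i j =>
    ∑ T ∈ J.powersetCard (j + 1), ∑ S ∈ J.powersetCard (i + 1), Q S T ^ M with hZ
  have hZle : ∀ i j, i ≤ j → j < K → Z i j ≤ K * (12 * c / n : ℝ) ^ M * (1 / 2) ^ j := by
    intro i j hij hjK
    have h1 : ∀ T, ∀ S ∈ J.powersetCard (i + 1), Q S T ^ M ≤
        (levelWeight c (i + 1) / n.choose (i + 1)) ^ (M - 1) * Q S T := by
      intro T S hS
      have hcard := (mem_powersetCard.1 hS).2
      have hne : S.Nonempty := card_pos.1 (by omega)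
      calc Q S T ^ M = Q S T ^ (M - 1) * Q S T := by
            rw [← Real.rpow_add_one' (hQ0 S T) (by linarith), sub_add_cancel]
        _ ≤ _ := by
            have := hQ1 S T hne
            rw [hcard] at this
            have h0 := hQ0 S T
            have : Q S T ^ (M - 1) ≤ _ := Real.rpow_le_rpow h0 this (by linarith : 0 ≤ M - 1)
            exact mul_le_mul_of_nonneg_right this h0
    calc Z i j ≤ ∑ T ∈ J.powersetCard (j + 1), ∑ S ∈ J.powersetCard (i + 1),
          (levelWeight c (i + 1) / n.choose (i + 1)) ^ (M - 1) * Q S T :=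
          sum_le_sum fun T _ => sum_le_sum (h1 T)
      _ = (levelWeight c (i + 1) / n.choose (i + 1)) ^ (M - 1) *
          ∑ T ∈ J.powersetCard (j + 1), ∑ S ∈ J.powersetCard (i + 1), Q S T := by
          simp only [mul_sum]
      _ ≤ (levelWeight c (i + 1) / n.choose (i + 1)) ^ (M - 1) *
          (K.choose (j + 1) / n.choose (j + 1) * levelWeight c (i + 1)) := by
          have := levelWeight_nonneg c (i + 1)
          exact mul_le_mul_of_nonneg_left (hQ2 _ _ (by omega)) (by positivity)
      _ ≤ _ := offDiagonal_term_le (s := i + 1) (t := j + 1) (by omega) (by omega) (by omega)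
          hKn hc hM hθ
  have hZsymm : ∀ i j, Z i j = Z j i := by
    intro i j
    simp only [hZ]
    rw [sum_comm]
    exact sum_congr rfl fun S _ => sum_congr rfl fun T _ => by rw [hQsymm]
  have hZmax : ∀ i ∈ range K, ∀ j ∈ range K,
      Z i j ≤ K * (12 * c / n : ℝ) ^ M * (1 / 2) ^ max i j := by
    intro i hi j hj
    rcases le_total i j with h | h
    · rw [max_eq_right h]; exact hZle i j h (mem_range.1 hj)
    · rw [max_eq_left h, hZsymm]; exact hZle j i h (mem_range.1 hi)
  calc ∑ S ∈ A, ∑ T ∈ A, Q S T ^ M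
      ≤ ∑ i ∈ range K, ∑ S ∈ J.powersetCard (i + 1), ∑ T ∈ A, Q S T ^ M := by
        rw [← hJ]
        exact sum_le_sum_powersetCard J A hA _ fun S => sum_nonneg fun T _ => hP0 S T
    _ ≤ ∑ i ∈ range K, ∑ S ∈ J.powersetCard (i + 1), ∑ j ∈ range K,
          ∑ T ∈ J.powersetCard (j + 1), Q S T ^ M := by
        refine sum_le_sum fun i _ => sum_le_sum fun S _ => ?_
        rw [← hJ]
        exact sum_le_sum_powersetCard J A hA _ fun T => hP0 S T
    _ = ∑ i ∈ range K, ∑ j ∈ range K, Z i j := by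
        refine sum_congr rfl fun i _ => ?_
        rw [sum_comm]
        refine sum_congr rfl fun j _ => ?_
        rw [sum_comm]
    _ ≤ ∑ i ∈ range K, ∑ j ∈ range K, K * (12 * c / n : ℝ) ^ M * (1 / 2) ^ max i j :=
        sum_le_sum fun i hi => sum_le_sum fun j hj => hZmax i hi j hj
    _ = K * (12 * c / n : ℝ) ^ M * (6 - (4 * K + 6) * (1 / 2) ^ K) := by
        rw [← sum_sum_half_pow_max]
        simp only [mul_sum]
    _ ≤ K * (12 * c / n : ℝ) ^ M * 8 := by
        refine mul_le_mul_of_nonneg_left ?_ hθ0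
        have : (0 : ℝ) ≤ (4 * K + 6) * (1 / 2) ^ K := by positivity
        linarith
    _ = _ := mul_comm _ _

end

/-! ### Conditioning in product spaces and counting messages -/

lemma expect_piFinset_prod {κ : Type*} [Fintype κ] [DecidableEq κ] {α : κ → Type*}
    (t : ∀ e, Finset (α e)) (f : ∀ e, α e → ℝ) :
    𝔼 x ∈ Fintype.piFinset t, ∏ e, f e (x e) = ∏ e, 𝔼 a ∈ t e, f e a := by
  simp only [expect_eq_sum_div_card, prod_div_distrib, prod_univ_sum, Fintype.card_piFinset,
    Nat.cast_prod]

lemma expect_pi_prod {κ : Type*} [Fintype κ] [DecidableEq κ] {α : κ → Type*}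
    [∀ e, Fintype (α e)] (f : ∀ e, α e → ℝ) :
    𝔼 x : ∀ e, α e, ∏ e, f e (x e) = ∏ e, 𝔼 a, f e a := by
  rw [← expect_piFinset_prod, Fintype.piFinset_univ]

/-- A fibre of the tuple of messages is the product of the individual fibres. -/
lemma condAvg_pi_prod {κ X β : Type*} [Fintype κ] [DecidableEq κ] [Fintype X]
    (m : κ → X → β) (f : κ → X → ℝ) (x : κ → X) :
    condAvg (fun x e => m e (x e)) (fun x => ∏ e, f e (x e)) x =
      ∏ e, condAvg (m e) (f e) (x e) := by
  classical
  simp only [condAvg]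
  rw [← expect_piFinset_prod]
  refine expect_congr ?_ fun _ _ => rfl
  ext z
  simp [funext_iff]

lemma condAvg_prod_snd {X Z β : Type*} [Fintype X] [Fintype Z] (m : Z → X → β)
    (φ : X × Z → ℝ) (x : X) (z : Z) :
    condAvg (fun p : X × Z => (p.2, m p.2 p.1)) φ (x, z) =
      condAvg (m z) (fun x => φ (x, z)) x := by
  classical
  symm
  refine expect_bij (fun a _ => (a, z)) ?_ ?_ ?_ ?_
  · intro a ha; simpa using ha
  · intro a ha; rfl
  · intro a ha b hb h; simpa using h
  · rintro ⟨a, w⟩ h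
    simp only [mem_filter, mem_univ, true_and, Prod.mk.injEq] at h
    obtain ⟨rfl, h⟩ := h
    exact ⟨a, by simpa using h, rfl⟩

lemma condAvg_sum {X β κ : Type*} [Fintype X] (m : X → β) (s : Finset κ) (φ : κ → X → ℝ) (y : X) :
    condAvg m (fun x => ∑ i ∈ s, φ i x) y = ∑ i ∈ s, condAvg m (φ i) y :=
  expect_sum_comm _ _ _

lemma sum_abs_condAvg {X β : Type*} [Fintype X] [DecidableEq β] (m : X → β) (φ : X → ℝ) :
    ∑ r ∈ univ.image m, |∑ x with m x = r, φ x| = ∑ y, |condAvg m φ y| := by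
  rw [← sum_fiberwise_of_maps_to (t := univ.image m) fun x _ => mem_image_of_mem m (mem_univ x)]
  refine sum_congr rfl fun r hr => ?_
  obtain ⟨z, -, rfl⟩ := mem_image.1 hr
  have hpos : (0 : ℝ) < #(univ.filter fun x => m x = m z) := by
    exact_mod_cast (card_pos.2 ⟨z, by simp⟩)
  have h : ∀ y ∈ univ.filter (fun y => m y = m z), |condAvg m φ y| =
      |∑ x with m x = m z, φ x| / #(univ.filter fun x => m x = m z) := by
    intro y hy
    rw [condAvg_congr m φ (mem_filter.1 hy).2, condAvg, expect_eq_sum_div_card, abs_div,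
      Nat.abs_cast]
    congr!
  rw [sum_congr rfl h, sum_const, nsmul_eq_mul, mul_div_cancel₀ _ hpos.ne']

lemma expect_abs_sq_le {X : Type*} [Fintype X] [Nonempty X] (f : X → ℝ) :
    (𝔼 x, |f x|) ^ 2 ≤ 𝔼 x, f x ^ 2 := by
  simpa only [sq_abs] using
    expect_pow_le_expect_pow (univ_nonempty (α := X)) (fun x => |f x|) (n := 2) (Or.inl even_two)

/-- The bit strings of length at most `c`. -/
def shortStrings (c : ℕ) : Finset (List Bool) :=
  (range (c + 1)).biUnion fun k => univ.image fun v : List.Vector Bool k => v.toList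

lemma mem_shortStrings {c : ℕ} {l : List Bool} (h : l.length ≤ c) : l ∈ shortStrings c :=
  mem_biUnion.2 ⟨l.length, mem_range.2 (by omega), mem_image.2 ⟨⟨l, rfl⟩, mem_univ _, rfl⟩⟩

lemma card_shortStrings_le (c : ℕ) : #(shortStrings c) ≤ 2 ^ (c + 1) := by
  calc #(shortStrings c) ≤ ∑ k ∈ range (c + 1), 2 ^ k := by
        refine card_biUnion_le.trans (sum_le_sum fun k _ => card_image_le.trans ?_)
        simp [card_vector]
    _ ≤ 2 ^ (c + 1) := (Nat.geomSum_lt le_rfl (by simp)).le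

lemma sum_corr_self_le_levelWeight {ι : Type*} [Fintype ι] [DecidableEq ι] {c : ℕ}
    (m : (ι → ZMod 2) → List Bool) (hm : ∀ x, (m x).length ≤ c) {s : ℕ} (hs : 1 ≤ s) :
    ∑ S ∈ univ.powersetCard s, corr m S S ≤ levelWeight c s := by
  -- There are at most 2^(c+1) messages, and k = ⌊c/s⌋ + 1 is the least moment with c + 1 ≤ sk; then
  -- 2(2k - 1) ≤ 2 + 4c/s.
  have hk : c + 1 ≤ s * (c / s + 1) := Nat.lt_mul_div_succ c hs
  refine (sum_corr_self_le m (shortStrings c) (fun x => mem_shortStrings (hm x))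
    (card_shortStrings_le c) (Nat.succ_pos _) hk).trans ?_
  have h : ((c / s : ℕ) : ℝ) ≤ c / s := Nat.cast_div_le
  have h0 : (0 : ℝ) ≤ (c / s : ℕ) := by positivity
  unfold levelWeight
  push_cast
  refine pow_le_pow_left₀ (by linarith) ?_ s
  rw [mul_div_assoc]
  linarith

/-- Merges the edges into a single weighted mean, which inherits the bounds on the individual q_e
that are symmetric or linear in q_e. -/
lemma prod_rpow_le_rpow {κ : Type*} [Fintype κ] (y q : κ → ℝ) (hy : ∀ e, 0 ≤ y e)
    (hq : ∀ e, 0 ≤ q e) {M : ℝ} (hM : M = ∑ e, y e) (hM0 : 0 < M) :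
    ∏ e, q e ^ y e ≤ (∑ e, y e / M * q e) ^ M := by
  have h := Real.geom_mean_le_arith_mean_weighted univ (fun e => y e / M) q
    (fun e _ => div_nonneg (hy e) hM0.le) (by rw [← sum_div, ← hM, div_self hM0.ne'])
    fun e _ => hq e
  have h2 := Real.rpow_le_rpow (prod_nonneg fun e _ => Real.rpow_nonneg (hq e) _) h hM0.le
  refine le_trans (le_of_eq ?_) h2
  rw [← Real.finsetProd_rpow _ _ fun e _ => Real.rpow_nonneg (hq e) _]
  refine prod_congr rfl fun e _ => ?_
  rw [← Real.rpow_mul (hq e), div_mul_cancel₀ _ hM0.ne']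

end BooleanCube

/-! ### Player messages and averaging over the permutations -/

namespace PromiseCounting

open Finset BooleanCube
open scoped BigOperators

variable {V E : Type*} [Fintype E] {n T : ℕ}

/-- The message of player `e`, as a function of the permutations it depends on and of `x_e`. -/
def playerMessage {H : MultiHypergraph V E} {G : Layout E n T} (m : Protocol H G) (e : E)
    (π : Equiv.Perm (G.block e)) (ρ : V → Equiv.Perm (Fin (groundSize E n T)))
    (x : Fin n → ZMod 2) : List Bool :=
  m e (fun i => x ((G.rho e).symm (π.symm i)), fun v i => ρ v (π.symm i : G.block e))

variable {H : MultiHypergraph V E} {G : Layout E n T} (m : Protocol H G)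

lemma message_eq (X : Strings E n) (P : Perms V G) (e : E) :
    m e (playerInput H G X P e) = playerMessage m e (P.1 e) P.2 (X e) := rfl

/-- The permutation `π_e` may be absorbed into the other permutations and the string. -/
lemma playerMessage_eq (e : E) (π : Equiv.Perm (G.block e))
    (ρ : V → Equiv.Perm (Fin (groundSize E n T))) :
    playerMessage m e π ρ = fun x => playerMessage m e 1
      (ρ * fun _ => Equiv.Perm.ofSubtype π⁻¹) (x ∘ ((G.rho e).symm.permCongr π).symm) := by
  funext x
  unfold playerMessage
  congr 2
  · funext i
    change _ = x ((G.rho e).symm (π.symm ((G.rho e) ((G.rho e).symm i))))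
    rw [Equiv.apply_symm_apply]
  · funext v i
    change _ = ρ v (Equiv.Perm.ofSubtype π⁻¹ (i : Fin (groundSize E n T)))
    rw [Equiv.Perm.ofSubtype_apply_coe]
    rfl

lemma playerMessage_update [DecidableEq V] (e : E) (π : Equiv.Perm (G.block e))
    (ρ : V → Equiv.Perm (Fin (groundSize E n T))) {v : V} (hv : v ∉ H.ends e)
    (σ : Equiv.Perm (Fin (groundSize E n T))) :
    playerMessage m e π (Function.update ρ v σ) = playerMessage m e π ρ := by
  funext x
  unfold playerMessage
  congr 2
  funext w i
  have : (w : V) ≠ v := by rintro rfl; exact hv w.2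
  simp [this]

/-- Every string occurs as the string of player `e` on an input satisfying the promise. -/
lemma length_playerMessage_le (hE : 1 < Fintype.card E) {K c : ℕ}
    (hm : ∀ (b : ZMod 2) (X : Strings E n) (P : Perms V G), Promise K b X →
      ∀ e, (m e (playerInput H G X P e)).length ≤ c) (e : E) (π : Equiv.Perm (G.block e))
    (ρ : V → Equiv.Perm (Fin (groundSize E n T))) (x : Fin n → ZMod 2) :
    (playerMessage m e π ρ x).length ≤ c := by
  classical
  obtain ⟨a, ha⟩ := Fintype.exists_ne_of_one_lt_card hE e
  -- The second copy of x, at another edge, cancels the first modulo 2, so the promise holds with τ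
  -- = 0.
  let X : Strings E n := fun b => if b = e ∨ b = a then x else 0
  have hX : Promise K 0 X := by
    intro i _
    have h1 : ∀ b, X b i = (if b = e then x i else 0) + (if b = a then x i else 0) := by
      intro b
      by_cases hb : b = e
      · subst hb; simp [X, Ne.symm ha]
      · by_cases hb' : b = a
        · subst hb'; simp [X, ha]
        · simp [X, hb, hb']
    simp only [h1, sum_add_distrib]
    simp [CharTwo.add_self_eq_zero]
  have h := hm 0 X (Function.update (fun _ => 1) e π, ρ) hX e
  rw [message_eq m] at h
  simpa [X] using h

variable [Fintype V]

open Classical in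
/-- The bound on the squared correlations of the messages of player `e`, averaged over the
permutations. -/
noncomputable def avgCorr (e : E) (S T' : Finset (Fin n)) : ℝ :=
  𝔼 ρ : V → Equiv.Perm (Fin (groundSize E n T)), avgSq (playerMessage m e 1 ρ) S T'

-- After π_e is absorbed, the translated (π_v) is uniform for every fixed π_e, so the two averages
-- decouple and π_e acts only by placing S and T'.
open Classical in
lemma expect_corr_sq_eq (e : E) (S T' : Finset (Fin n)) :
    𝔼 ρ : V → Equiv.Perm (Fin (groundSize E n T)), 𝔼 π : Equiv.Perm (G.block e),
      corr (playerMessage m e π ρ) S T' ^ 2 = avgCorr m e S T' := by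
  unfold avgCorr avgSq
  have h : 𝔼 ρ : V → Equiv.Perm (Fin (groundSize E n T)), 𝔼 τ : Equiv.Perm (Fin n),
      corr (playerMessage m e 1 ρ) (S.map τ.toEmbedding) (T'.map τ.toEmbedding) ^ 2 =
      𝔼 τ : Equiv.Perm (Fin n), 𝔼 ρ : V → Equiv.Perm (Fin (groundSize E n T)),
        corr (playerMessage m e 1 ρ) (S.map τ.toEmbedding) (T'.map τ.toEmbedding) ^ 2 :=
    expect_comm _ _ _
  rw [h, expect_comm]
  refine Fintype.expect_equiv (G.rho e).symm.permCongr _ _ fun π => ?_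
  refine Fintype.expect_equiv (Equiv.mulRight fun _ => Equiv.Perm.ofSubtype π⁻¹) _ _ fun ρ => ?_
  rw [playerMessage_eq, corr_comp_perm (fun x => playerMessage m e 1 _ x)]
  rfl

open Classical in
/-- The cross terms of the second moment, bounded by Finner's inequality. -/
lemma expect_prod_corr_le (y : E → ℝ) (hy : ∀ e, 0 ≤ y e ∧ y e ≤ 1 / 2)
    (hsum : ∀ v, ∑ e with v ∈ H.ends e, y e ≤ 1) (S T' : Finset (Fin n)) :
    𝔼 P : Perms V G, ∏ e, corr (playerMessage m e (P.1 e) P.2) S T' ≤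
      ∏ e, avgCorr m e S T' ^ y e := by
  set F : E → (V → Equiv.Perm (Fin (groundSize E n T))) → ℝ := fun e ρ =>
    𝔼 π : Equiv.Perm (G.block e), corr (playerMessage m e π ρ) S T' ^ 2 with hF
  have hF0 : ∀ e ρ, 0 ≤ F e ρ := fun e ρ => expect_nonneg fun _ _ => sq_nonneg _
  have hF1 : ∀ e ρ, F e ρ ≤ 1 := fun e ρ => expect_le univ_nonempty fun _ _ => corr_sq_le_one _ _ _
  have hle : ∀ e ρ, |𝔼 π : Equiv.Perm (G.block e), corr (playerMessage m e π ρ) S T'| ≤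
      F e ρ ^ y e := by
    intro e ρ
    have h1 : |𝔼 π : Equiv.Perm (G.block e), corr (playerMessage m e π ρ) S T'| ≤
        F e ρ ^ (1 / 2 : ℝ) := by
      rw [← Real.sqrt_eq_rpow]
      exact Real.abs_le_sqrt (expect_pow_le_expect_pow univ_nonempty _ (Or.inl even_two))
    refine h1.trans ?_
    -- Since F ≤ 1, lowering the exponent from 1/2 to y_e only increases the bound; this is why the
    -- matching is capped at 1/2.
    rcases (hF0 e ρ).eq_or_lt with h0 | h0
    · rw [← h0, Real.zero_rpow (by norm_num)]
      exact Real.rpow_nonneg le_rfl _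
    · exact Real.rpow_le_rpow_of_exponent_ge h0 (hF1 e ρ) (hy e).2
  calc 𝔼 P : Perms V G, ∏ e, corr (playerMessage m e (P.1 e) P.2) S T'
      = 𝔼 ρ, ∏ e, 𝔼 π : Equiv.Perm (G.block e), corr (playerMessage m e π ρ) S T' := by
        rw [← univ_product_univ, expect_product, expect_comm]
        refine expect_congr rfl fun ρ _ => ?_
        rw [← expect_pi_prod fun e π => corr (playerMessage m e π ρ) S T']
    _ ≤ 𝔼 ρ, ∏ e, F e ρ ^ y e := by
        refine expect_le_expect fun ρ _ => (le_abs_self _).trans ?_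
        rw [abs_prod]
        exact prod_le_prod (fun e _ => abs_nonneg _) fun e _ => hle e ρ
    _ ≤ ∏ e, (𝔼 ρ, F e ρ) ^ y e := by
        -- Player e sees π_v only for v ∈ e, so the mean square depends only on the coordinates in
        -- e.
        refine MultiHypergraph.finner H y (fun e => (hy e).1) hsum F hF0 fun e v hv ρ σ => ?_
        simp only [hF]
        exact expect_congr rfl fun π _ => by rw [playerMessage_update m e π ρ hv]
    _ = _ := prod_congr rfl fun e _ => by rw [← expect_corr_sq_eq]

end PromiseCounting

/-! ### Fourier expansion of the hard distribution -/

namespace PromiseCounting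

open Finset BooleanCube
open scoped BigOperators

section Fourier

variable {E : Type*} [Fintype E] {n : ℕ}

/-- The first `K` positions. -/
def core (n K : ℕ) : Finset (Fin n) := univ.filter fun i => (i : ℕ) < K

lemma card_core {n K : ℕ} (hK : K ≤ n) : #(core n K) = K := by
  rw [core, Fin.card_filter_val_lt]
  exact min_eq_right hK

lemma half_one_add_sgn_mul (a b : ZMod 2) :
    (1 / 2 : ℝ) * (1 + sgn b * sgn a) = if a = b then 1 else 0 := by
  rcases zmod_two_cases a with rfl | rfl <;> rcases zmod_two_cases b with rfl | rfl <;> norm_num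

-- Expand the product over i < K of (1 + sgn(b) sgn(∑_e x_e(i)))/2.
open Classical in
lemma promise_indicator (K : ℕ) (b : ZMod 2) (X : Strings E n) :
    (if Promise K b X then (1 : ℝ) else 0) = (1 / 2) ^ #(core n K) *
      ∑ S ∈ (core n K).powerset, sgn b ^ #S * ∏ e, chi S (X e) := by
  have h1 : (if Promise K b X then (1 : ℝ) else 0) =
      ∏ i ∈ core n K, (1 / 2 : ℝ) * (1 + sgn b * sgn (∑ e, X e i)) := by
    simp only [half_one_add_sgn_mul]
    by_cases h : Promise K b X
    · rw [if_pos h]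
      exact (prod_eq_one fun i hi => if_pos (h i (mem_filter.1 hi).2)).symm
    · rw [if_neg h]
      simp only [Promise, not_forall] at h
      obtain ⟨i, hi, hne⟩ := h
      exact (prod_eq_zero (mem_filter.2 ⟨mem_univ i, hi⟩) (if_neg hne)).symm
  rw [h1, prod_mul_distrib, prod_const, prod_one_add]
  congr 1
  refine sum_congr rfl fun S _ => ?_
  rw [prod_mul_distrib, prod_const]
  simp only [sgn_sum, chi]
  rw [prod_comm]

open Classical in
lemma expect_prod_chi [Nonempty E] (S : Finset (Fin n)) :
    𝔼 X : Strings E n, ∏ e, chi S (X e) = if S = ∅ then 1 else 0 := by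
  rw [expect_pi_prod fun (_ : E) x => chi S x]
  simp only [expect_chi]
  split_ifs <;> simp

-- Only S = ∅ survives, so the normalisation is the same for both values of τ.
open Classical in
lemma expect_sum_prod_chi [Nonempty E] (K : ℕ) (b : ZMod 2) :
    𝔼 X : Strings E n, ∑ S ∈ (core n K).powerset, sgn b ^ #S * ∏ e, chi S (X e) = 1 := by
  rw [expect_sum_comm]
  simp only [← mul_expect, expect_prod_chi]
  simp

open Classical in
lemma card_promise [Nonempty E] (K : ℕ) (b : ZMod 2) :
    (Nat.card {X : Strings E n // Promise K b X} : ℝ) =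
      (1 / 2) ^ #(core n K) * Fintype.card (Strings E n) := by
  have h : (Fintype.card (Strings E n) : ℝ) ≠ 0 := by exact_mod_cast Fintype.card_ne_zero
  have h1 : (Nat.card {X : Strings E n // Promise K b X} : ℝ) =
      ∑ X : Strings E n, if Promise K b X then (1 : ℝ) else 0 := by
    rw [Nat.card_eq_fintype_card, Fintype.card_subtype, sum_boole]
  have h2 := expect_sum_prod_chi (E := E) (n := n) K b
  rw [Fintype.expect_eq_sum_div_card, div_eq_one_iff_eq h] at h2
  rw [h1]
  simp only [promise_indicator]
  rw [← mul_sum, h2]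

end Fourier

section Mass

variable {V E : Type*} [Fintype E] {n T : ℕ} (G : Layout E n T) (K : ℕ)

lemma hardMass_nonneg (ω : Outcome V G) : 0 ≤ hardMass G K ω := by
  unfold hardMass
  split_ifs <;> positivity

variable [Fintype V]

open Classical in
lemma hardMass_eq [Nonempty E] (b : ZMod 2) (X : Strings E n) (P : Perms V G) :
    hardMass G K (b, X, P) = 1 / 2 * (∑ S ∈ (core n K).powerset, sgn b ^ #S * ∏ e, chi S (X e)) /
      Fintype.card (Strings E n × Perms V G) := by
  have h1 : (Fintype.card (Strings E n) : ℝ) ≠ 0 := by exact_mod_cast Fintype.card_ne_zero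
  have h2 : (Fintype.card (Perms V G) : ℝ) ≠ 0 := by exact_mod_cast Fintype.card_ne_zero
  have h3 : hardMass G K (b, X, P) = (if Promise K b X then (1 : ℝ) else 0) * ((1 / 2) *
      (1 / (Nat.card {X : Strings E n // Promise K b X} : ℝ)) *
      (1 / (Nat.card (Perms V G) : ℝ))) := by
    unfold hardMass
    simp only [ite_mul, one_mul, zero_mul]
  have h4 : (Fintype.card (Strings E n × Perms V G) : ℝ) =
      Fintype.card (Strings E n) * Fintype.card (Perms V G) := by
    exact_mod_cast Fintype.card_prod (Strings E n) (Perms V G)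
  rw [h3, promise_indicator, card_promise, Nat.card_eq_fintype_card, h4]
  field_simp

open Classical in
lemma sum_hardMass [Nonempty E] : ∑ ω : Outcome V G, hardMass G K ω = 1 := by
  have hb : ∀ b : ZMod 2, ∑ p : Strings E n × Perms V G, hardMass G K (b, p) = 1 / 2 := by
    intro b
    have h := expect_sum_prod_chi (E := E) (n := n) K b
    calc ∑ p : Strings E n × Perms V G, hardMass G K (b, p)
        = 𝔼 p : Strings E n × Perms V G,
          1 / 2 * (∑ S ∈ (core n K).powerset, sgn b ^ #S * ∏ e, chi S (p.1 e)) := by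
          rw [Fintype.expect_eq_sum_div_card, sum_div]
          exact sum_congr rfl fun p _ => hardMass_eq G K b p.1 p.2
      _ = 1 / 2 := by
          rw [← mul_expect, ← univ_product_univ, expect_product]
          simp only [Fintype.expect_const]
          rw [h, mul_one]
  rw [Fintype.sum_prod_type, sum_congr rfl fun b _ => hb b, sum_const, card_univ, ZMod.card]
  norm_num

/-- The signed density `∑_{S ⊆ [K], |S| odd} ∏_e χ_S(x_e)` by which the two conditional
distributions of the strings differ. -/
def signedDensity (X : Strings E n) : ℝ :=
  ∑ S ∈ (core n K).powerset.filter (fun S => Odd #S), ∏ e, chi S (X e)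

-- Even-size sets cancel; odd-size sets double, which removes the prior 1/2.
open Classical in
lemma hardMass_sub [Nonempty E] (p : Strings E n × Perms V G) :
    hardMass G K (0, p) - hardMass G K (1, p) =
      signedDensity K p.1 / Fintype.card (Strings E n × Perms V G) := by
  obtain ⟨X, P⟩ := p
  rw [hardMass_eq, hardMass_eq, ← sub_div, ← mul_sub, ← sum_sub_distrib, signedDensity, sum_filter,
    mul_sum]
  congr 1
  refine sum_congr rfl fun S _ => ?_
  rw [sgn_zero, sgn_one]
  split_ifs with h
  · rw [h.neg_one_pow]; ring
  · rw [(Nat.not_odd_iff_even.1 h).neg_one_pow]; ring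

end Mass

/-! ### The referee's advantage and its second moment -/

section Advantage

variable {V E : Type*} [Fintype E] {n T : ℕ} {H : MultiHypergraph V E}
  {G : Layout E n T} (K : ℕ) (m : Protocol H G)

/-- What the referee sees, as a function of the strings and the permutations. -/
def viewOf (p : Strings E n × Perms V G) : View V G :=
  (p.2, fun e => playerMessage m e (p.2.1 e) p.2.2 (p.1 e))

lemma view_eq (ω : Outcome V G) : view m ω = viewOf m ω.2 := rfl

variable [Fintype V]

open Classical in
/-- The joint probability of the value `b` of `τ` and the view `r`. -/
noncomputable def jointProb (b : ZMod 2) (r : View V G) : ℝ :=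
  ∑ p with viewOf m p = r, hardMass G K (b, p)

lemma jointProb_nonneg (b : ZMod 2) (r : View V G) : 0 ≤ jointProb K m b r :=
  sum_nonneg fun _ _ => hardMass_nonneg G K _

lemma sum_zmod_two (f : ZMod 2 → ℝ) : ∑ b, f b = f 0 + f 1 := Fin.sum_univ_two f

open Classical in
lemma hardExp_eq_sum (f : ZMod 2 → View V G → ℝ) :
    hardExp G K (fun ω => f ω.1 (view m ω)) =
      ∑ r ∈ univ.image (viewOf m), ∑ b, jointProb K m b r * f b r := by
  unfold hardExp jointProb
  rw [Fintype.sum_prod_type, sum_comm (s := univ.image _)]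
  refine sum_congr rfl fun b _ => ?_
  rw [← sum_fiberwise_of_maps_to (t := univ.image (viewOf m))
    fun p _ => mem_image_of_mem _ (mem_univ p)]
  refine sum_congr rfl fun r _ => ?_
  rw [sum_mul]
  refine sum_congr rfl fun p hp => ?_
  change _ * f b (viewOf m p) = _
  rw [(mem_filter.1 hp).2]

open Classical in
lemma hardProb_joint (b : ZMod 2) (r : View V G) :
    hardProb G K (fun ω => ω.1 = b ∧ view m ω = r) = jointProb K m b r := by
  unfold hardProb hardExp jointProb
  rw [Fintype.sum_prod_type, sum_eq_single b]
  · rw [sum_filter]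
    exact sum_congr rfl fun p _ => by simp [view_eq]
  · intro a _ ha
    exact sum_eq_zero fun p _ => by simp [ha]
  · simp

open Classical in
lemma hardProb_view (r : View V G) :
    hardProb G K (fun ω => view m ω = r) = jointProb K m 0 r + jointProb K m 1 r := by
  rw [← sum_zmod_two fun b => jointProb K m b r]
  unfold hardProb hardExp jointProb
  rw [Fintype.sum_prod_type]
  refine sum_congr rfl fun b _ => ?_
  rw [sum_filter]
  refine sum_congr rfl fun p _ => ?_
  by_cases h : viewOf m p = r <;> simp [view_eq, h]

open Classical in
/-- The total variation distance between the two conditional distributions of the view. -/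
noncomputable def advantage : ℝ :=
  1 / 2 * ∑ r ∈ univ.image (viewOf m), |jointProb K m 0 r - jointProb K m 1 r|

lemma hardExp_tvUniform_posterior :
    hardExp G K (fun ω => tvUniform (posterior K m (view m ω))) = advantage K m := by
  classical
  rw [hardExp_eq_sum K m fun _ r => tvUniform (posterior K m r), advantage, mul_sum]
  refine sum_congr (by congr!) fun r _ => ?_
  rw [← sum_mul, sum_zmod_two]
  unfold tvUniform posterior
  simp only [hardProb_joint, hardProb_view, sum_zmod_two]
  have h0 := jointProb_nonneg K m 0 r
  have h1 := jointProb_nonneg K m 1 r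
  set p := jointProb K m 0 r
  set q := jointProb K m 1 r
  -- A view of probability zero has posterior 0/0 = 0, but it carries no weight.
  rcases (add_nonneg h0 h1).eq_or_lt with h | h
  · have hp : p = 0 := by linarith
    have hq : q = 0 := by linarith
    simp [hp, hq]
  · have e1 : p / (p + q) - 1 / 2 = (p - q) / (2 * (p + q)) := by field_simp; ring
    have e2 : q / (p + q) - 1 / 2 = -((p - q) / (2 * (p + q))) := by field_simp; ring
    rw [e1, e2, abs_neg, abs_div, abs_of_pos (by positivity : 0 < 2 * (p + q))]
    field_simp
    ring

/-- For each view the chosen joint probability is at most max(p,q) = (p+q)/2 + |p-q|/2. -/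
lemma hardProb_guess_le [Nonempty E] (guess : View V G → ZMod 2) :
    hardProb G K (fun ω => guess (view m ω) = ω.1) ≤ 1 / 2 + advantage K m := by
  classical
  have htot : ∑ r ∈ univ.image (viewOf m), (jointProb K m 0 r + jointProb K m 1 r) = 1 := by
    have h := hardExp_eq_sum K m fun _ _ => 1
    simp only [mul_one, sum_zmod_two] at h
    rw [← h, hardExp]
    simp only [mul_one]
    exact sum_hardMass G K
  have h := hardExp_eq_sum K m fun b r => if guess r = b then 1 else 0
  have h2 : hardProb G K (fun ω => guess (view m ω) = ω.1) =
      ∑ r ∈ univ.image (viewOf m), ∑ b, jointProb K m b r * if guess r = b then 1 else 0 := by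
    rw [← h, hardProb]
    refine congrArg _ (funext fun ω => ?_)
    split_ifs <;> rfl
  rw [h2]
  calc ∑ r ∈ univ.image (viewOf m), ∑ b, jointProb K m b r * (if guess r = b then 1 else 0)
      ≤ ∑ r ∈ univ.image (viewOf m), (1 / 2 * (jointProb K m 0 r + jointProb K m 1 r) +
          1 / 2 * |jointProb K m 0 r - jointProb K m 1 r|) := by
        refine sum_le_sum fun r _ => ?_
        rw [sum_zmod_two]
        have h1 := le_abs_self (jointProb K m 0 r - jointProb K m 1 r)
        have h2 := neg_abs_le (jointProb K m 0 r - jointProb K m 1 r)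
        rcases zmod_two_cases (guess r) with hg | hg <;> rw [hg] <;> simp <;> linarith
    _ = 1 / 2 + advantage K m := by
        rw [sum_add_distrib, ← mul_sum, ← mul_sum, htot, mul_one, advantage]

open Classical in
lemma advantage_eq [Nonempty E] :
    advantage K m = 1 / 2 * 𝔼 p : Strings E n × Perms V G,
      |condAvg (viewOf m) (fun p => signedDensity K p.1) p| := by
  rw [advantage, Fintype.expect_eq_sum_div_card, ← sum_abs_condAvg, sum_div]
  congr 1
  refine sum_congr (by congr!) fun r _ => ?_
  unfold jointProb
  rw [← sum_sub_distrib, sum_congr rfl fun p _ => hardMass_sub G K p, ← sum_div, abs_div,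
    Nat.abs_cast]

-- The view contains Π, so conditioning fixes it; under the uniform reference measure the strings
-- are independent and the conditional means multiply.
open Classical in
lemma condAvg_signedDensity (X : Strings E n) (P : Perms V G) :
    condAvg (viewOf m) (fun p => signedDensity K p.1) (X, P) =
      ∑ S ∈ (core n K).powerset.filter (fun S => Odd #S),
        ∏ e, condAvg (playerMessage m e (P.1 e) P.2) (chi S) (X e) := by
  have h := condAvg_prod_snd (fun (P : Perms V G) (X : Strings E n) e =>
    playerMessage m e (P.1 e) P.2 (X e)) (fun p => signedDensity K p.1) X P
  refine h.trans ?_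
  unfold signedDensity
  rw [condAvg_sum]
  exact sum_congr rfl fun S _ =>
    condAvg_pi_prod (fun e => playerMessage m e (P.1 e) P.2) (fun _ => chi S) X

open Classical in
/-- The second moment of the posterior bias. -/
lemma expect_condAvg_sq_le (y : E → ℝ) (hy : ∀ e, 0 ≤ y e ∧ y e ≤ 1 / 2)
    (hsum : ∀ v, ∑ e with v ∈ H.ends e, y e ≤ 1) :
    𝔼 p : Strings E n × Perms V G, condAvg (viewOf m) (fun p => signedDensity K p.1) p ^ 2 ≤
      ∑ S ∈ (core n K).powerset.filter (fun S => Odd #S),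
        ∑ T' ∈ (core n K).powerset.filter (fun S => Odd #S), ∏ e, avgCorr m e S T' ^ y e := by
  rw [← univ_product_univ, expect_product, expect_comm]
  simp only [condAvg_signedDensity, pow_two, sum_mul_sum, ← prod_mul_distrib]
  simp only [expect_sum_comm]
  refine sum_le_sum fun S _ => sum_le_sum fun T' _ => ?_
  refine le_trans (le_of_eq ?_) (expect_prod_corr_le m y hy hsum S T')
  refine expect_congr rfl fun P _ => ?_
  exact expect_pi_prod fun e x => condAvg (playerMessage m e (P.1 e) P.2) (chi S) x *
    condAvg (playerMessage m e (P.1 e) P.2) (chi T') x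

end Advantage

/-! ### Assembling the second-moment bound -/

section Bound

variable {V E : Type*} [Fintype V] [Fintype E] {n T : ℕ} {H : MultiHypergraph V E}
  {G : Layout E n T} (m : Protocol H G)

lemma avgCorr_nonneg (e : E) (S T' : Finset (Fin n)) : 0 ≤ avgCorr m e S T' :=
  expect_nonneg fun _ _ => avgSq_nonneg _ _ _

lemma avgCorr_comm (e : E) (S T' : Finset (Fin n)) : avgCorr m e S T' = avgCorr m e T' S :=
  expect_congr rfl fun _ _ => avgSq_comm _ _ _

variable {c : ℕ}

lemma avgCorr_le (hm : ∀ e (ρ : V → Equiv.Perm (Fin (groundSize E n T))) x,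
      (playerMessage m e 1 ρ x).length ≤ c)
    (e : E) {S : Finset (Fin n)} (hS : S.Nonempty) (T' : Finset (Fin n)) :
    avgCorr m e S T' ≤ levelWeight c #S / n.choose #S := by
  classical
  refine expect_le univ_nonempty fun ρ _ => (avgSq_le _ _ _).trans ?_
  rw [Fintype.card_fin]
  gcongr
  exact sum_corr_self_le_levelWeight _ (hm e ρ) hS.card_pos

lemma sum_sum_avgCorr_le (hm : ∀ e (ρ : V → Equiv.Perm (Fin (groundSize E n T))) x,
      (playerMessage m e 1 ρ x).length ≤ c)
    (e : E) (J : Finset (Fin n)) {s : ℕ} (hs : 1 ≤ s) (t : ℕ) :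
    ∑ T' ∈ J.powersetCard t, ∑ S ∈ J.powersetCard s, avgCorr m e S T' ≤
      (#J).choose t / n.choose t * levelWeight c s := by
  classical
  unfold avgCorr
  simp only [← expect_sum_comm]
  refine expect_le univ_nonempty fun ρ _ => (sum_sum_avgSq_le _ J s t).trans ?_
  rw [Fintype.card_fin]
  gcongr
  exact sum_corr_self_le_levelWeight _ (hm e ρ) hs

open Classical in
lemma advantage_sq_le [Nonempty E] {K : ℕ} (hm : ∀ e (ρ : V → Equiv.Perm (Fin (groundSize E n T))) x,
      (playerMessage m e 1 ρ x).length ≤ c)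
    (y : E → ℝ) (hy : ∀ e, 0 ≤ y e ∧ y e ≤ 1 / 2)
    (hsum : ∀ v, ∑ e with v ∈ H.ends e, y e ≤ 1) {M : ℝ} (hMy : M = ∑ e, y e) (hM : 1 ≤ M)
    (hKn : 10 * K ≤ n) (hc : 1 ≤ c) (hθ : K * (12 * c / n : ℝ) ^ M ≤ 1 / 2) :
    advantage K m ^ 2 ≤ 2 * (K * (12 * c / n : ℝ) ^ M) := by
  set A := (core n K).powerset.filter fun S => Odd #S with hA
  have hM0 : 0 < M := by linarith
  have hyM : ∑ e, y e / M = 1 := by rw [← sum_div, ← hMy, div_self hM0.ne']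
  have hw : ∀ e, 0 ≤ y e / M := fun e => div_nonneg (hy e).1 hM0.le
  have hK : #(core n K) = K := card_core (by omega)
  -- Apply the summation bound to the mean of `avgCorr` with weights y_e/M; odd sets are nonempty,
  -- as the level bounds require.
  have hmain : ∑ S ∈ A, ∑ T' ∈ A, (∑ e, y e / M * avgCorr m e S T') ^ M ≤
      8 * (K * (12 * c / n : ℝ) ^ M) := by
    refine sum_sum_rpow_le (core n K) hK A (fun S hS => ?_)
      (fun S T' => ∑ e, y e / M * avgCorr m e S T')
      (fun S T' => sum_nonneg fun e _ => mul_nonneg (hw e) (avgCorr_nonneg m e S T'))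
      (fun S T' => sum_congr rfl fun e _ => by rw [avgCorr_comm])
      (fun S T' hS => ?_) (fun s t hs => ?_) hKn hc hM hθ
    · obtain ⟨h1, h2⟩ := mem_filter.1 hS
      exact ⟨mem_powerset.1 h1, card_pos.1 h2.pos⟩
    · calc ∑ e, y e / M * avgCorr m e S T'
          ≤ ∑ e, y e / M * (levelWeight c #S / n.choose #S) :=
            sum_le_sum fun e _ => mul_le_mul_of_nonneg_left (avgCorr_le m hm e hS T') (hw e)
        _ = _ := by rw [← sum_mul, hyM, one_mul]
    · calc ∑ T' ∈ (core n K).powersetCard t, ∑ S ∈ (core n K).powersetCard s,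
            ∑ e, y e / M * avgCorr m e S T'
          = ∑ e, y e / M * ∑ T' ∈ (core n K).powersetCard t, ∑ S ∈ (core n K).powersetCard s,
            avgCorr m e S T' := by
            simp only [mul_sum]
            exact (sum_congr rfl fun T' _ => sum_comm).trans sum_comm
        _ ≤ ∑ e, y e / M * (K.choose t / n.choose t * levelWeight c s) := by
            refine sum_le_sum fun e _ => mul_le_mul_of_nonneg_left ?_ (hw e)
            have := sum_sum_avgCorr_le m hm e (core n K) hs t
            rwa [hK] at this
        _ = _ := by rw [← sum_mul, hyM, one_mul]
  have hsq : 𝔼 p : Strings E n × Perms V G,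
      condAvg (viewOf m) (fun p => signedDensity K p.1) p ^ 2 ≤ 8 * (K * (12 * c / n : ℝ) ^ M) :=
    (expect_condAvg_sq_le K m y hy hsum).trans <| (sum_le_sum fun S _ => sum_le_sum fun T' _ =>
      prod_rpow_le_rpow y _ (fun e => (hy e).1) (fun e => avgCorr_nonneg m e S T') hMy hM0).trans
      hmain
  have habs := expect_abs_sq_le fun p : Strings E n × Perms V G =>
    condAvg (viewOf m) (fun p => signedDensity K p.1) p
  -- The squared prefactor 1/4 turns 8 into 2.
  rw [advantage_eq, mul_pow]
  linarith

end Bound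

end PromiseCounting

theorem theorem5p1 {V E : Type*} [Fintype V] [Fintype E] (H : MultiHypergraph V E)
    (hconn : H.Connected) (hE : 1 < Fintype.card E) :
    ∃ γ : ℝ, 0 < γ ∧
      ∀ (n T K : ℕ) (ε : ℝ), 1 ≤ K → K ≤ T → T ≤ n → ε = (K : ℝ) / (T : ℝ) →
      ε * (T : ℝ) ≤ (n : ℝ) / 10 →
      ∀ (G : PromiseCounting.Layout E n T) (m : PromiseCounting.Protocol H G) (c : ℕ) (δ : ℝ),
      1 ≤ c → c ≤ n → 0 < δ → δ < 1 →
      (∀ (b : ZMod 2) (X : PromiseCounting.Strings E n) (P : PromiseCounting.Perms V G),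
        PromiseCounting.Promise K b X →
        ∀ e, (m e (PromiseCounting.playerInput H G X P e)).length ≤ c) →
      (c : ℝ) ≤ γ * ((n : ℝ) *
        (δ ^ 2 / (ε * (T : ℝ))) ^ (1 / (H.mvc 2⁻¹ (fun _ => 1)).toReal)) →
      PromiseCounting.hardExp G K
          (fun ω => PromiseCounting.tvUniform
            (PromiseCounting.posterior K m (PromiseCounting.view m ω))) ≤ δ ∧
        ∀ guess : PromiseCounting.View V G → ZMod 2,
          PromiseCounting.hardProb G K (fun ω => guess (PromiseCounting.view m ω) = ω.1)
            ≤ 1 / 2 + δ := by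
  classical
  have : Nonempty E := Fintype.card_pos_iff.1 (by omega)
  obtain ⟨y, hy, hsum, hmvc⟩ := H.exists_fractional_matching
  have hone := H.one_le_mvc hE
  set M : ℝ := ∑ e, y e with hM
  have hfin : H.mvc 2⁻¹ (fun _ => 1) ≠ ⊤ := (hmvc.trans_lt ENNReal.ofReal_lt_top).ne
  have hy0 : 0 ≤ M := Finset.sum_nonneg fun e _ => (hy e).1
  have hμ1 : 1 ≤ (H.mvc 2⁻¹ (fun _ => 1)).toReal := by
    simpa using ENNReal.toReal_mono hfin hone
  have hμM : (H.mvc 2⁻¹ (fun _ => 1)).toReal ≤ M := ENNReal.toReal_le_of_le_ofReal hy0 hmvc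
  set μ : ℝ := (H.mvc 2⁻¹ (fun _ => 1)).toReal with hμ
  -- With 1/24, the hypothesis on c reads 12c/n ≤ a/2, where a = (δ²/K)^(1/μ).
  refine ⟨1 / 24, by norm_num, ?_⟩
  intro n T K ε hK hKT hTn hε hεn G m c δ hc hcn hδ hδ1 hlen hcγ
  have hT0 : (T : ℝ) ≠ 0 := by
    have : T ≠ 0 := by omega
    exact_mod_cast this
  have hεT : ε * T = K := by rw [hε, div_mul_cancel₀ _ hT0]
  rw [hεT] at hεn hcγ
  have hKn : 10 * K ≤ n := by
    have : (10 : ℝ) * K ≤ n := by linarith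
    exact_mod_cast this
  have hn0 : (0 : ℝ) < n := by
    have : 0 < n := by omega
    exact_mod_cast this
  have hK0 : (0 : ℝ) < K := by exact_mod_cast hK
  have hK1 : (1 : ℝ) ≤ K := by exact_mod_cast hK
  have hδK0 : 0 < δ ^ 2 / K := by positivity
  have hδK1 : δ ^ 2 / K ≤ 1 := (div_le_one hK0).2 (by nlinarith)
  set a : ℝ := (δ ^ 2 / K) ^ (1 / μ) with ha
  have ha0 : 0 < a := Real.rpow_pos_of_pos hδK0 _
  have ha1 : a ≤ 1 := Real.rpow_le_one hδK0.le hδK1 (by positivity)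
  have h12 : 12 * (c : ℝ) / n ≤ a / 2 := by
    rw [div_le_iff₀ hn0]; linarith
  have hθ : K * (12 * c / n : ℝ) ^ M ≤ δ ^ 2 / 2 := by
    -- The base a/2 is below 1, so M may be replaced by the smaller exponent μ.
    have h1 : (12 * c / n : ℝ) ^ M ≤ (a / 2) ^ μ := by
      calc (12 * c / n : ℝ) ^ M ≤ (a / 2) ^ M :=
            Real.rpow_le_rpow (by positivity) h12 hy0
        _ ≤ (a / 2) ^ μ := Real.rpow_le_rpow_of_exponent_ge (by positivity) (by linarith) hμM
    have h2 : a ^ μ = δ ^ 2 / K := by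
      rw [ha, ← Real.rpow_mul hδK0.le, one_div_mul_cancel (by linarith), Real.rpow_one]
    -- As μ ≥ 1, halving the base gains at least a factor 2, which pays for the 2 in
    -- `advantage_sq_le`.
    have h3 : (2 : ℝ) ≤ 2 ^ μ := by
      simpa using Real.rpow_le_rpow_of_exponent_le (by norm_num : (1 : ℝ) ≤ 2) hμ1
    rw [Real.div_rpow ha0.le (by norm_num), h2] at h1
    calc K * (12 * c / n : ℝ) ^ M ≤ K * (δ ^ 2 / K / 2 ^ μ) := by gcongr
      _ ≤ K * (δ ^ 2 / K / 2) := by gcongr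
      _ = δ ^ 2 / 2 := by field_simp
  have hadv : PromiseCounting.advantage K m ≤ δ := by
    have h := PromiseCounting.advantage_sq_le m
      (fun e ρ x => PromiseCounting.length_playerMessage_le m hE hlen e 1 ρ x) y hy
      (fun v => by convert hsum v) hM (hμ1.trans hμM) hKn hc (hθ.trans (by nlinarith))
    exact le_of_pow_le_pow_left₀ two_ne_zero hδ.le (by linarith)
  exact ⟨(PromiseCounting.hardExp_tvUniform_posterior K m).trans_le hadv,
    fun guess => (PromiseCounting.hardProb_guess_le K m guess).trans (by linarith)⟩
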